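/- Let $l\ge 1$. For a field $k$ with $\operatorname{char} k\ne 2$ and a matrix $\beta$ let the similitude group of $\beta$ consist of the invertible $g$ with ${}^T g\beta g=\mu(g)\beta$ for some $\mu(g)\in k^\times$. Let $\mathrm{GSp}(2l,k)$, $\mathrm{GO}(2l,k)$, $\mathrm{GO}(2l+1,k)$ be the similitude groups of $$\begin{pmatrix}0&I_l\\-I_l&0\end{pmatrix},\qquad \begin{pmatrix}0&I_l\\I_l&0\end{pmatrix},\qquad \begin{pmatrix}2&0&0\\0&0&I_l\\0&I_l&0\end{pmatrix}$$ (rows and columns indexed by $1,\dots,l,-1,\dots,-l$, preceded by $0$ in the odd case), and, for a finite field $k=\mathbb F_q$ of odd characteristic and a non-square $\epsilon\in k^\times$, let $\mathrm{GO}^-(2l,q)$ be the similitude group of $\operatorname{diag}(1,\epsilon)\oplus\begin{pmatrix}0&I_{l-1}\\I_{l-1}&0\end{pmatrix}$ (indices $1,-1,2,\dots,l,-2,\dots,-l$). With $e_{i,j}$ the matrix units and $t,s\in k$, the elementary matrices are the following. * All groups, with $1\le i,j\le l$ (and $2\le i,j\le l$ for $\mathrm{GO}^-$): $x_{i,j}(t)=I+t(e_{i,j}-e_{-j,-i})$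 for $i\ne j$, and for $i<j$: $x_{i,-j}(t)=I+t(e_{i,-j}\mp e_{j,-i})$ and $x_{-i,j}(t)=I+t(e_{-i,j}\mp e_{-j,i})$, with the sign $+$ for $\mathrm{GSp}$ and $-$ for the orthogonal groups. * $\mathrm{GSp}(2l,k)$: also $x_{i,-i}(t)=I+te_{i,-i}$ and $x_{-i,i}(t)=I+te_{-i,i}$. * $\mathrm{GO}(2l,k)$ and $\mathrm{GO}(2l+1,k)$: also $w_l$, where $w_i=I-e_{i,i}-e_{-i,-i}-e_{i,-i}-e_{-i,i}$. * $\mathrm{GO}(2l+1,k)$: also $x_{i,0}(t)=I+t(2e_{i,0}-e_{0,-i})-t^2e_{i,-i}$ and $x_{0,i}(t)=I+t(-2e_{-i,0}+e_{0,i})-t^2e_{-i,i}$. * $\mathrm{GO}^-(2l,q)$: also, for $2\le i\le l$, $x_{i,1}(t)=I+t(-e_{-i,1}+e_{1,i})-\tfrac{t^2}{2}e_{-i,i}$, $x_{1,i}(t)=I+t(e_{i,1}-e_{1,-i})-\tfrac{t^2}{2}e_{i,-i}$, $x_{i,-1}(t)=I+t(-\epsilon e_{-i,-1}+e_{-1,i})-\tfrac{\epsilon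 t^2}{2}e_{-i,i}$, $x_{-1,i}(t)=I+t(\epsilon e_{i,-1}-e_{-1,-i})-\tfrac{\epsilon t^2}{2}e_{i,-i}$, $w_i$, and moreover $x_1(t,s)=I+(t-1)e_{1,1}-(t+1)e_{-1,-1}+s(e_{-1,1}+\epsilon e_{1,-1})$ and $x_2=I-2e_{-1,-1}$. **Theorem A.** There is an absolute constant $C$ such that every element $g$ of one of these groups can be written as $g=WD$, where $W$ is a product of at most $C\,l^3$ elementary matrices of that group and $D$ is a diagonal matrix, namely, for suitable $\alpha,\lambda\in k^\times$: * $D=\operatorname{diag}(1,\dots,1,\mu(g),\dots,\mu(g))$ for $\mathrm{GSp}(2l,k)$; * $D=\operatorname{diag}(1,\dots,1,\lambda,\mu(g),\dots,\mu(g),\mu(g)\lambda^{-1})$ for $\mathrm{GO}(2l,k)$; * $D=\operatorname{diag}(\alpha,1,\dots,1,\lambda,\mu(g),\dots,\mu(g),\mu(g)\lambda^{-1})$ with $\alpha^2=\mu(g)$ for $\mathrm{GO}(2l+1,k)$; * $D=\operatorname{diag}(1,1,1,\dots,1,\lambda,\mu(g),\dots,\mu(g),\mu(g)\lambda^{-1})$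 for $\mathrm{GO}^-(2l,q)$ (with $D=I_2$ when $l=1$); here every letter $x_1(t,s)$ in $W$ satisfies $t^2+\epsilon s^2=\mu(g)$. Moreover, the word is produced by a Gaussian elimination algorithm: for each of the four types and each $l$ there is a finite decision tree, independent of the field $k$, of $\epsilon$ and of $g$, which, started at the matrix $g$, at each step either tests whether an arithmetic expression (formed with $+$, $\cdot$, inversion with the convention $0^{-1}=0$, and integers, and $\epsilon$ in the twisted case) in the entries of the current matrix $M$ vanishes, or computes an elementary matrix $E$ whose parameters are such expressions, appends $E$ to the word, and replaces $M$ by $E^{-1}M$; it ends with the word $W$ and with $M=D$. -/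

import Mathlib

open Matrix

namespace SimilitudeWord

/-! ## Similitude groups of a bilinear form -/

section Similitude

variable {ι : Type*} [Fintype ι] [DecidableEq ι] {k : Type*} [Field k]

/-- `c` is a multiplier of `g` for the form with matrix `β`: `ᵗg β g = c β`. -/
def HasMultiplier (β : Matrix ι ι k) (g : GL ι k) (c : kˣ) : Prop :=
  (g : Matrix ι ι k)ᵀ * β * (g : Matrix ι ι k) = (c : k) • β

/-- The group of similitudes of the bilinear form with matrix `β`. -/
def similitudeGroup (β : Matrix ι ι k) : Subgroup (GL ι k) where
  carrier := {g | ∃ c : kˣ, HasMultiplier β g c}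
  one_mem' := ⟨1, by simp [HasMultiplier]⟩
  mul_mem' := by
    rintro g h ⟨c, hc⟩ ⟨d, hd⟩
    refine ⟨c * d, ?_⟩
    unfold HasMultiplier at *
    have : ((g * h : GL ι k) : Matrix ι ι k)ᵀ * β * ((g * h : GL ι k) : Matrix ι ι k)
        = (h : Matrix ι ι k)ᵀ * ((g : Matrix ι ι k)ᵀ * β * (g : Matrix ι ι k))
            * (h : Matrix ι ι k) := by
      simp [Matrix.mul_assoc, Matrix.transpose_mul]
    rw [this, hc, Matrix.mul_smul, Matrix.smul_mul, hd, smul_smul, Units.val_mul]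
  inv_mem' := by
    rintro g ⟨c, hc⟩
    refine ⟨c⁻¹, ?_⟩
    unfold HasMultiplier at *
    have h1 : (g : Matrix ι ι k) * ((g⁻¹ : GL ι k) : Matrix ι ι k) = 1 := by
      rw [← Units.val_mul, mul_inv_cancel, Units.val_one]
    have h2 : ((g⁻¹ : GL ι k) : Matrix ι ι k)ᵀ * (g : Matrix ι ι k)ᵀ = 1 := by
      rw [← Matrix.transpose_mul, h1, Matrix.transpose_one]
    have h3 : ((g⁻¹ : GL ι k) : Matrix ι ι k)ᵀ *
        ((g : Matrix ι ι k)ᵀ * β * (g : Matrix ι ι k)) * ((g⁻¹ : GL ι k) : Matrix ι ι k) = β := by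
      calc _ = (((g⁻¹ : GL ι k) : Matrix ι ι k)ᵀ * (g : Matrix ι ι k)ᵀ) * β *
            ((g : Matrix ι ι k) * ((g⁻¹ : GL ι k) : Matrix ι ι k)) := by
              simp only [Matrix.mul_assoc]
        _ = β := by rw [h1, h2, Matrix.one_mul, Matrix.mul_one]
    rw [hc, Matrix.mul_smul, Matrix.smul_mul] at h3
    calc _ = ((c⁻¹ : kˣ) : k) • ((c : k) • (((g⁻¹ : GL ι k) : Matrix ι ι k)ᵀ * β *
            ((g⁻¹ : GL ι k) : Matrix ι ι k))) := by
              rw [smul_smul, ← Units.val_mul, inv_mul_cancel, Units.val_one, one_smul]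
      _ = _ := by rw [h3]

end Similitude

/-! ## Index sets

`inl i` stands for the index `i` and `inr i` for the index `-i`. -/

/-- The indices `1, …, l, -1, …, -l`. -/
abbrev EvenIdx (l : ℕ) : Type := Fin l ⊕ Fin l

/-- The indices `0, 1, …, l, -1, …, -l`. -/
abbrev OddIdx (l : ℕ) : Type := Unit ⊕ (Fin l ⊕ Fin l)

/-- The indices `1, -1, 2, …, l, -2, …, -l` for `l = m + 1`: the element `0 : Fin 2` is the
index `1`, the element `1 : Fin 2` is the index `-1`, and `i : Fin m` is counted from `2`. -/
abbrev TwIdx (m : ℕ) : Type := Fin 2 ⊕ (Fin m ⊕ Fin m)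

/-! ## The forms and the groups -/

/-- The alternating form `(0, I; -I, 0)`. -/
def symplecticForm (l : ℕ) (k : Type*) [Field k] : Matrix (EvenIdx l) (EvenIdx l) k :=
  fromBlocks 0 1 (-1) 0

/-- The split symmetric form `(0, I; I, 0)`. -/
def evenForm (l : ℕ) (k : Type*) [Field k] : Matrix (EvenIdx l) (EvenIdx l) k :=
  fromBlocks 0 1 1 0

/-- The split symmetric form `(2) ⊕ (0, I; I, 0)`. -/
def oddForm (l : ℕ) (k : Type*) [Field k] : Matrix (OddIdx l) (OddIdx l) k :=
  fromBlocks (diagonal fun _ => 2) 0 0 (evenForm l k)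

/-- The symmetric form `diag(1, ε) ⊕ (0, I; I, 0)`. -/
def twistedForm (m : ℕ) {k : Type*} [Field k] (ε : k) : Matrix (TwIdx m) (TwIdx m) k :=
  fromBlocks (diagonal ![1, ε]) 0 0 (evenForm m k)

/-- `GSp(2l, k)`. -/
def GSp (l : ℕ) (k : Type*) [Field k] : Subgroup (GL (EvenIdx l) k) :=
  similitudeGroup (symplecticForm l k)

/-- `GO(2l, k)`. -/
def GOEven (l : ℕ) (k : Type*) [Field k] : Subgroup (GL (EvenIdx l) k) :=
  similitudeGroup (evenForm l k)

/-- `GO(2l+1, k)`. -/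
def GOOdd (l : ℕ) (k : Type*) [Field k] : Subgroup (GL (OddIdx l) k) :=
  similitudeGroup (oddForm l k)

/-- `GO⁻(2l, k)` for `l = m + 1` (used for a finite field `k` and a non-square `ε`). -/
def GOTwisted (m : ℕ) {k : Type*} [Field k] (ε : k) : Subgroup (GL (TwIdx m) k) :=
  similitudeGroup (twistedForm m ε)

/-! ## Elementary matrices

For every group there is a type of letters, with parameters in a type `R`, and the matrix of a
letter whose parameters lie in a field. Below, `e (i) (j)` is the matrix unit. -/

section Letters

variable {ι : Type*} [DecidableEq ι]

/-- The matrix unit `e_{i,j}`. -/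
def e {k : Type*} [Field k] (i j : ι) : Matrix ι ι k := Matrix.single i j 1

/-- Letters for `GSp(2l, k)`. -/
inductive GSpLetter (l : ℕ) (R : Type*)
  /-- `x_{i,j}(t)` -/
  | x (i j : Fin l) (h : i ≠ j) (t : R)
  /-- `x_{i,-j}(t)` -/
  | xUp (i j : Fin l) (h : i < j) (t : R)
  /-- `x_{-i,j}(t)` -/
  | xDown (i j : Fin l) (h : i < j) (t : R)
  /-- `x_{i,-i}(t)` -/
  | xUpDiag (i : Fin l) (t : R)
  /-- `x_{-i,i}(t)` -/
  | xDownDiag (i : Fin l) (t : R)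

/-- Change of the parameters of a letter. -/
def GSpLetter.map {l : ℕ} {R S : Type*} (f : R → S) : GSpLetter l R → GSpLetter l S
  | x i j h t => x i j h (f t)
  | xUp i j h t => xUp i j h (f t)
  | xDown i j h t => xDown i j h (f t)
  | xUpDiag i t => xUpDiag i (f t)
  | xDownDiag i t => xDownDiag i (f t)

/-- The elementary matrices of `GSp(2l, k)`. -/
def GSpLetter.toMatrix {l : ℕ} {k : Type*} [Field k] :
    GSpLetter l k → Matrix (EvenIdx l) (EvenIdx l) k
  | x i j _ t => 1 + t • (e (.inl i) (.inl j) - e (.inr j) (.inr i))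
  | xUp i j _ t => 1 + t • (e (.inl i) (.inr j) + e (.inl j) (.inr i))
  | xDown i j _ t => 1 + t • (e (.inr i) (.inl j) + e (.inr j) (.inl i))
  | xUpDiag i t => 1 + t • e (.inl i) (.inr i)
  | xDownDiag i t => 1 + t • e (.inr i) (.inl i)

/-- Letters for `GO(2l, k)`. -/
inductive GOEvenLetter (l : ℕ) (R : Type*)
  /-- `x_{i,j}(t)` -/
  | x (i j : Fin l) (h : i ≠ j) (t : R)
  /-- `x_{i,-j}(t)` -/
  | xUp (i j : Fin l) (h : i < j) (t : R)
  /-- `x_{-i,j}(t)` -/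
  | xDown (i j : Fin l) (h : i < j) (t : R)
  /-- `w_l`, where `i` is the last index -/
  | w (i : Fin l) (h : i.val + 1 = l)

/-- Change of the parameters of a letter. -/
def GOEvenLetter.map {l : ℕ} {R S : Type*} (f : R → S) : GOEvenLetter l R → GOEvenLetter l S
  | x i j h t => x i j h (f t)
  | xUp i j h t => xUp i j h (f t)
  | xDown i j h t => xDown i j h (f t)
  | w i h => w i h

/-- The elementary matrices of `GO(2l, k)`. -/
def GOEvenLetter.toMatrix {l : ℕ} {k : Type*} [Field k] :
    GOEvenLetter l k → Matrix (EvenIdx l) (EvenIdx l) k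
  | x i j _ t => 1 + t • (e (.inl i) (.inl j) - e (.inr j) (.inr i))
  | xUp i j _ t => 1 + t • (e (.inl i) (.inr j) - e (.inl j) (.inr i))
  | xDown i j _ t => 1 + t • (e (.inr i) (.inl j) - e (.inr j) (.inl i))
  | w i _ => 1 - e (.inl i) (.inl i) - e (.inr i) (.inr i)
      - e (.inl i) (.inr i) - e (.inr i) (.inl i)

/-- Letters for `GO(2l+1, k)`. -/
inductive GOOddLetter (l : ℕ) (R : Type*)
  /-- `x_{i,j}(t)` -/
  | x (i j : Fin l) (h : i ≠ j) (t : R)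
  /-- `x_{i,-j}(t)` -/
  | xUp (i j : Fin l) (h : i < j) (t : R)
  /-- `x_{-i,j}(t)` -/
  | xDown (i j : Fin l) (h : i < j) (t : R)
  /-- `x_{i,0}(t)` -/
  | xZeroRight (i : Fin l) (t : R)
  /-- `x_{0,i}(t)` -/
  | xZeroLeft (i : Fin l) (t : R)
  /-- `w_l`, where `i` is the last index -/
  | w (i : Fin l) (h : i.val + 1 = l)

/-- Change of the parameters of a letter. -/
def GOOddLetter.map {l : ℕ} {R S : Type*} (f : R → S) : GOOddLetter l R → GOOddLetter l S
  | x i j h t => x i j h (f t)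
  | xUp i j h t => xUp i j h (f t)
  | xDown i j h t => xDown i j h (f t)
  | xZeroRight i t => xZeroRight i (f t)
  | xZeroLeft i t => xZeroLeft i (f t)
  | w i h => w i h

/-- The elementary matrices of `GO(2l+1, k)`. -/
def GOOddLetter.toMatrix {l : ℕ} {k : Type*} [Field k] :
    GOOddLetter l k → Matrix (OddIdx l) (OddIdx l) k
  | x i j _ t => 1 + t • (e (.inr (.inl i)) (.inr (.inl j)) - e (.inr (.inr j)) (.inr (.inr i)))
  | xUp i j _ t =>
      1 + t • (e (.inr (.inl i)) (.inr (.inr j)) - e (.inr (.inl j)) (.inr (.inr i)))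
  | xDown i j _ t =>
      1 + t • (e (.inr (.inr i)) (.inr (.inl j)) - e (.inr (.inr j)) (.inr (.inl i)))
  | xZeroRight i t =>
      1 + t • ((2 : k) • e (.inr (.inl i)) (.inl ()) - e (.inl ()) (.inr (.inr i)))
        - t ^ 2 • e (.inr (.inl i)) (.inr (.inr i))
  | xZeroLeft i t =>
      1 + t • (-((2 : k) • e (.inr (.inr i)) (.inl ())) + e (.inl ()) (.inr (.inl i)))
        - t ^ 2 • e (.inr (.inr i)) (.inr (.inl i))
  | w i _ => 1 - e (.inr (.inl i)) (.inr (.inl i)) - e (.inr (.inr i)) (.inr (.inr i))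
      - e (.inr (.inl i)) (.inr (.inr i)) - e (.inr (.inr i)) (.inr (.inl i))

/-- Letters for `GO⁻(2l, q)`, `l = m + 1`; here `i` and `j` are indices other than `±1`. -/
inductive GOTwistedLetter (m : ℕ) (R : Type*)
  /-- `x_{i,j}(t)` -/
  | x (i j : Fin m) (h : i ≠ j) (t : R)
  /-- `x_{i,-j}(t)` -/
  | xUp (i j : Fin m) (h : i < j) (t : R)
  /-- `x_{-i,j}(t)` -/
  | xDown (i j : Fin m) (h : i < j) (t : R)
  /-- `x_{i,1}(t)` -/
  | xOneRight (i : Fin m) (t : R)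
  /-- `x_{1,i}(t)` -/
  | xOneLeft (i : Fin m) (t : R)
  /-- `x_{i,-1}(t)` -/
  | xNegOneRight (i : Fin m) (t : R)
  /-- `x_{-1,i}(t)` -/
  | xNegOneLeft (i : Fin m) (t : R)
  /-- `w_i` -/
  | w (i : Fin m)
  /-- `x_1(t, s)` -/
  | x1 (t s : R)
  /-- `x_2` -/
  | x2

/-- Change of the parameters of a letter. -/
def GOTwistedLetter.map {m : ℕ} {R S : Type*} (f : R → S) :
    GOTwistedLetter m R → GOTwistedLetter m S
  | x i j h t => x i j h (f t)
  | xUp i j h t => xUp i j h (f t)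
  | xDown i j h t => xDown i j h (f t)
  | xOneRight i t => xOneRight i (f t)
  | xOneLeft i t => xOneLeft i (f t)
  | xNegOneRight i t => xNegOneRight i (f t)
  | xNegOneLeft i t => xNegOneLeft i (f t)
  | w i => w i
  | x1 t s => x1 (f t) (f s)
  | x2 => x2

/-- The elementary matrices of `GO⁻(2l, q)`, `l = m + 1`. The coefficients of the four families
`x_{i,±1}`, `x_{±1,i}` are those for which these matrices preserve `diag(1, ε) ⊕ (0, I; I, 0)`.
The matrix `x_1(t, s)` multiplies `diag(1, ε)` by `t ^ 2 + ε * s ^ 2`. -/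
def GOTwistedLetter.toMatrix {m : ℕ} {k : Type*} [Field k] (ε : k) :
    GOTwistedLetter m k → Matrix (TwIdx m) (TwIdx m) k
  | x i j _ t => 1 + t • (e (.inr (.inl i)) (.inr (.inl j)) - e (.inr (.inr j)) (.inr (.inr i)))
  | xUp i j _ t =>
      1 + t • (e (.inr (.inl i)) (.inr (.inr j)) - e (.inr (.inl j)) (.inr (.inr i)))
  | xDown i j _ t =>
      1 + t • (e (.inr (.inr i)) (.inr (.inl j)) - e (.inr (.inr j)) (.inr (.inl i)))
  | xOneRight i t =>
      1 + t • (-e (.inr (.inr i)) (.inl 0) + e (.inl 0) (.inr (.inl i)))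
        - (t ^ 2 / 2) • e (.inr (.inr i)) (.inr (.inl i))
  | xOneLeft i t =>
      1 + t • (e (.inr (.inl i)) (.inl 0) - e (.inl 0) (.inr (.inr i)))
        - (t ^ 2 / 2) • e (.inr (.inl i)) (.inr (.inr i))
  | xNegOneRight i t =>
      1 + t • (-(ε • e (.inr (.inr i)) (.inl 1)) + e (.inl 1) (.inr (.inl i)))
        - (ε * t ^ 2 / 2) • e (.inr (.inr i)) (.inr (.inl i))
  | xNegOneLeft i t =>
      1 + t • (ε • e (.inr (.inl i)) (.inl 1) - e (.inl 1) (.inr (.inr i)))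
        - (ε * t ^ 2 / 2) • e (.inr (.inl i)) (.inr (.inr i))
  | w i => 1 - e (.inr (.inl i)) (.inr (.inl i)) - e (.inr (.inr i)) (.inr (.inr i))
      - e (.inr (.inl i)) (.inr (.inr i)) - e (.inr (.inr i)) (.inr (.inl i))
  | x1 t s => 1 + (t - 1) • e (.inl 0) (.inl 0) - (t + 1) • e (.inl 1) (.inl 1)
      + s • (e (.inl 1) (.inl 0) + ε • e (.inl 0) (.inl 1))
  | x2 => 1 - (2 : k) • e (.inl 1) (.inl 1)

end Letters

/-! ## The diagonal matrices -/

/-- The entries `(1, …, 1, a, c, …, c, c a⁻¹)`, with `l` entries in each half (and with no entry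
at all when `l = 0`). -/
def diagEntries (l : ℕ) {k : Type*} [Field k] (a c : k) : EvenIdx l → k :=
  Sum.elim (fun i => if i.val + 1 = l then a else 1) (fun i => if i.val + 1 = l then c * a⁻¹ else c)

/-- `diag(1, …, 1, a, c, …, c, c a⁻¹)`. -/
def evenDiag (l : ℕ) {k : Type*} [Field k] (a c : k) : Matrix (EvenIdx l) (EvenIdx l) k :=
  diagonal (diagEntries l a c)

/-- `diag(α, 1, …, 1, a, c, …, c, c a⁻¹)`. -/
def oddDiag (l : ℕ) {k : Type*} [Field k] (α a c : k) : Matrix (OddIdx l) (OddIdx l) k :=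
  diagonal (Sum.elim (fun _ => α) (diagEntries l a c))

/-- `diag(1, 1, 1, …, 1, a, c, …, c, c a⁻¹)`. -/
def twistedDiag (m : ℕ) {k : Type*} [Field k] (a c : k) : Matrix (TwIdx m) (TwIdx m) k :=
  diagonal (Sum.elim (fun _ => 1) (diagEntries m a c))

/-! ## Elimination procedures

An elimination procedure is a finite decision tree that acts on a matrix by row operations. It
knows nothing about the field: it may test whether an arithmetic expression in the entries of the
current matrix is zero, and it may split off from the left an elementary matrix whose parameters
are such expressions. -/

/-- Arithmetic expressions in the entries of a matrix indexed by `ι` and in constants named by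
`π`. -/
inductive FieldExpr (ι π : Type)
  | entry (i j : ι)
  | const (p : π)
  | int (z : ℤ)
  | add (a b : FieldExpr ι π)
  | mul (a b : FieldExpr ι π)
  | inv (a : FieldExpr ι π)

/-- The value of an expression at a matrix `M`, where `c` gives the values of the constants. -/
def FieldExpr.eval {ι π : Type} {k : Type*} [Field k] (c : π → k) (M : Matrix ι ι k) :
    FieldExpr ι π → k
  | entry i j => M i j
  | const p => c p
  | int z => (z : k)
  | add a b => a.eval c M + b.eval c M
  | mul a b => a.eval c M * b.eval c M
  | inv a => (a.eval c M)⁻¹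

/-- Elimination procedures; `Γ` is a type of letters whose parameters are expressions. -/
inductive ElimTree (ι π Γ : Type)
  | halt
  | peel (x : Γ) (next : ElimTree ι π Γ)
  | ifZero (a : FieldExpr ι π) (yes no : ElimTree ι π Γ)

open Classical in
/-- Running an elimination procedure on a matrix `M`. A node `peel x` computes the letter `y` over
`k` given by `x` (via `sub`, which evaluates the parameters), writes `y` at the end of the word,
and replaces the current matrix `M` by `y⁻¹ * M`. The output is the word together with the matrix
that is left at the end. -/
noncomputable def ElimTree.run {ι π Γ : Type} [Fintype ι] {k : Type*} [Field k]
    {Λ : Type*} (sub : (FieldExpr ι π → k) → Γ → Λ) (mat : Λ → Matrix ι ι k) (c : π → k) :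
    ElimTree ι π Γ → Matrix ι ι k → List Λ × Matrix ι ι k
  | halt, M => ([], M)
  | peel x next, M =>
      let y := sub (FieldExpr.eval c M) x
      let r := next.run sub mat c ((mat y)⁻¹ * M)
      (y :: r.1, r.2)
  | ifZero a yes no, M =>
      if a.eval c M = 0 then yes.run sub mat c M else no.run sub mat c M

/-- Elimination procedures for `GSp(2l, -)`. -/
abbrev GSpTree (l : ℕ) : Type :=
  ElimTree (EvenIdx l) Empty (GSpLetter l (FieldExpr (EvenIdx l) Empty))

/-- Elimination procedures for `GO(2l, -)`. -/
abbrev GOEvenTree (l : ℕ) : Type :=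
  ElimTree (EvenIdx l) Empty (GOEvenLetter l (FieldExpr (EvenIdx l) Empty))

/-- Elimination procedures for `GO(2l+1, -)`. -/
abbrev GOOddTree (l : ℕ) : Type :=
  ElimTree (OddIdx l) Empty (GOOddLetter l (FieldExpr (OddIdx l) Empty))

/-- Elimination procedures for `GO⁻(2l, -)`, `l = m + 1`; the only constant is `ε`. -/
abbrev GOTwistedTree (m : ℕ) : Type :=
  ElimTree (TwIdx m) Unit (GOTwistedLetter m (FieldExpr (TwIdx m) Unit))

end SimilitudeWord

/-!
Everything is Gaussian elimination with row operations which preserve the form. The four forms are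
monomial: they pair each index `r` with an opposite index `opp r`. A Siegel transformation adds a
multiple of row `h` to row `r` and repairs the form in row `opp h`; up to renaming its parameters it
is one of the letters. Once a pivot is available, these operations clear its column except for the
entry in row `opp h`. That entry is cleared by a transvection if the form is alternating, and it
vanishes on its own, as the column is isotropic, if the form is symmetric and `2` is invertible. The
column being clear, invariance of the form clears row `opp h`, so that the next pairs of columns can
be treated in the same way without disturbing it. There are `l` stages with linearly many operations
each. At the end only the diagonal and the core, of rank at most two, remain.
-/

namespace SimilitudeWord

universe u

/-! ## Uniform reductions -/

section Reductions

/-- Run the second procedure after the first one. -/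
def ElimTree.append {ι π Γ : Type} : ElimTree ι π Γ → ElimTree ι π Γ → ElimTree ι π Γ
  | halt, U => U
  | peel x next, U => peel x (next.append U)
  | ifZero a yes no, U => ifZero a (yes.append U) (no.append U)

theorem ElimTree.run_append {ι π Γ : Type} [Fintype ι] {k : Type*} [Field k] {Λ : Type*}
    (sub : (FieldExpr ι π → k) → Γ → Λ) (mat : Λ → Matrix ι ι k) (c : π → k)
    (T U : ElimTree ι π Γ) (M : Matrix ι ι k) :
    (T.append U).run sub mat c M =
      ((T.run sub mat c M).1 ++ (U.run sub mat c (T.run sub mat c M).2).1,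
        (U.run sub mat c (T.run sub mat c M).2).2) := by
  induction T generalizing M with
  | halt => rfl
  | peel x next ih => simp only [append, run, ih, List.cons_append]
  | ifZero a yes no ih_yes ih_no =>
    simp only [append, run]
    split_ifs
    · exact ih_yes M
    · exact ih_no M

/-- The data over which a procedure has to work uniformly: a field, values of the constants
subject to the requirement `𝒜`, and the multiplier of the matrix to be reduced. -/
structure Setting (π : Type) (𝒜 : ∀ (k : Type u) [Field k], (π → k) → Prop) where
  k : Type u
  [field : Field k]
  c : π → k
  admissible : 𝒜 k c
  μ : kˣ

attribute [instance] Setting.field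

/-- Letters together with their matrices. Which letters are legal in a word may depend on the
multiplier; only `x_1(t, s)` makes use of this. -/
structure LetterSystem (ι π Γ : Type) (𝒜 : ∀ (k : Type u) [Field k], (π → k) → Prop) where
  Letter : Type u → Type u
  subst : ∀ {k : Type u}, (FieldExpr ι π → k) → Γ → Letter k
  mat : ∀ K : Setting π 𝒜, Letter K.k → Matrix ι ι K.k
  Legal : ∀ K : Setting π 𝒜, Letter K.k → Prop

variable {ι π Γ : Type} {𝒜 : ∀ (k : Type u) [Field k], (π → k) → Prop}

/-- The one-parameter family `A` of matrices consists of legal letters, uniformly in the field. -/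
def LetterSystem.Realizes (S : LetterSystem ι π Γ 𝒜)
    (A : ∀ K : Setting π 𝒜, K.k → Matrix ι ι K.k) : Prop :=
  ∀ a : FieldExpr ι π, ∃ x : Γ, ∀ (K : Setting π 𝒜) (M : Matrix ι ι K.k),
    S.Legal K (S.subst (FieldExpr.eval K.c M) x) ∧
      S.mat K (S.subst (FieldExpr.eval K.c M) x) = A K (a.eval K.c M)

theorem LetterSystem.Realizes.int_mul {S : LetterSystem ι π Γ 𝒜}
    {A : ∀ K : Setting π 𝒜, K.k → Matrix ι ι K.k} (h : S.Realizes A) (z : ℤ) :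
    S.Realizes fun K t => A K (z * t) :=
  fun a => h (.mul (.int z) a)

variable [Fintype ι] [DecidableEq ι]

/-- Some procedure takes every matrix with the property `P` to a matrix with the property `Q`,
over all settings, and writes at most `n` letters, all of them legal. -/
def LetterSystem.Reduces (S : LetterSystem ι π Γ 𝒜)
    (P Q : ∀ K : Setting π 𝒜, Matrix ι ι K.k → Prop) (n : ℕ) : Prop :=
  ∃ T : ElimTree ι π Γ, ∀ (K : Setting π 𝒜) (M : Matrix ι ι K.k), P K M →
    ∃ (word : List (S.Letter K.k)) (M' : Matrix ι ι K.k),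
      T.run S.subst (S.mat K) K.c M = (word, M') ∧ M = (word.map (S.mat K)).prod * M' ∧
        (∀ y ∈ word, S.Legal K y) ∧ word.length ≤ n ∧ Q K M'

namespace LetterSystem.Reduces

variable {S : LetterSystem ι π Γ 𝒜} {P P' Q R : ∀ K : Setting π 𝒜, Matrix ι ι K.k → Prop}
  {n m : ℕ}

theorem of_imp (h : ∀ K M, P K M → Q K M) : S.Reduces P Q n :=
  ⟨.halt, fun K M hP => ⟨[], M, rfl, (one_mul M).symm, by simp, n.zero_le, h K M hP⟩⟩

theorem of_false (h : ∀ K M, ¬ P K M) : S.Reduces P Q n :=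
  of_imp fun K M hP => (h K M hP).elim

theorem trans (h₁ : S.Reduces P Q n) (h₂ : S.Reduces Q R m) : S.Reduces P R (n + m) := by
  obtain ⟨T, hT⟩ := h₁
  obtain ⟨U, hU⟩ := h₂
  refine ⟨T.append U, fun K M hP => ?_⟩
  obtain ⟨w, M', hrun, hM, hlegal, hlen, hQ⟩ := hT K M hP
  obtain ⟨w', M'', hrun', hM', hlegal', hlen', hR⟩ := hU K M' hQ
  refine ⟨w ++ w', M'', ?_, ?_, ?_, ?_, hR⟩
  · rw [ElimTree.run_append, hrun, hrun']
  · rw [hM, hM', List.map_append, List.prod_append, Matrix.mul_assoc]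
  · exact fun y hy => (List.mem_append.1 hy).elim (hlegal y) (hlegal' y)
  · exact List.length_append.trans_le (add_le_add hlen hlen')

theorem mono (h : S.Reduces P Q n) (hnm : n ≤ m) : S.Reduces P Q m := by
  obtain ⟨T, hT⟩ := h
  refine ⟨T, fun K M hP => ?_⟩
  obtain ⟨w, M', hrun, hM, hlegal, hlen, hQ⟩ := hT K M hP
  exact ⟨w, M', hrun, hM, hlegal, hlen.trans hnm, hQ⟩

theorem imp_left (h : S.Reduces P Q n) (hP : ∀ K M, P' K M → P K M) : S.Reduces P' Q n :=
  ((of_imp hP).trans h).mono (zero_add n).le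

theorem imp_right (h : S.Reduces P Q n) (hQ : ∀ K M, Q K M → R K M) : S.Reduces P R n :=
  h.trans (of_imp (n := 0) hQ)

theorem ite (a : FieldExpr ι π)
    (hne : S.Reduces (fun K M => P K M ∧ a.eval K.c M ≠ 0) Q n)
    (heq : S.Reduces (fun K M => P K M ∧ a.eval K.c M = 0) Q n) : S.Reduces P Q n := by
  obtain ⟨T, hT⟩ := heq
  obtain ⟨U, hU⟩ := hne
  refine ⟨.ifZero a T U, fun K M hP => ?_⟩
  by_cases h0 : a.eval K.c M = 0
  · simpa only [ElimTree.run, if_pos h0] using hT K M ⟨hP, h0⟩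
  · simpa only [ElimTree.run, if_neg h0] using hU K M ⟨hP, h0⟩

theorem search {α : Type} (s : Finset α) (a : α → FieldExpr ι π)
    (hne : ∀ r ∈ s, S.Reduces (fun K M => P K M ∧ (a r).eval K.c M ≠ 0) Q n)
    (heq : S.Reduces (fun K M => P K M ∧ ∀ r ∈ s, (a r).eval K.c M = 0) Q n) :
    S.Reduces P Q n := by
  classical
  induction s using Finset.induction_on with
  | empty => exact heq.imp_left fun K M hP => ⟨hP, by simp⟩
  | insert r s _ ih =>
    refine ih (fun r hr => hne r (Finset.mem_insert_of_mem hr)) (ite (a r) ?_ ?_)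
    · exact (hne r (Finset.mem_insert_self r s)).imp_left fun K M h => ⟨h.1.1, h.2⟩
    · exact heq.imp_left fun K M h =>
        ⟨h.1.1, Finset.forall_mem_insert _ _ _ |>.2 ⟨h.2, h.1.2⟩⟩

theorem loop {α : Type} [DecidableEq α] (I : Finset α → ∀ K : Setting π 𝒜, Matrix ι ι K.k → Prop)
    (h : ∀ r s, S.Reduces (I s) (I (insert r s)) n) (s : Finset α) :
    S.Reduces (I ∅) (I s) (s.card * n) := by
  induction s using Finset.induction_on with
  | empty => exact of_imp fun _ _ hI => hI
  | insert r s hr ih =>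
    rw [Finset.card_insert_of_notMem hr, Nat.succ_mul]
    exact ih.trans (h r s)

theorem peel (x : Γ)
    (h : ∀ K M, P K M → S.Legal K (S.subst (FieldExpr.eval K.c M) x) ∧
      ∃ A, S.mat K (S.subst (FieldExpr.eval K.c M) x) * A = 1 ∧ Q K (A * M)) :
    S.Reduces P Q 1 := by
  refine ⟨.peel x .halt, fun K M hP => ?_⟩
  obtain ⟨hlegal, A, hA, hQ⟩ := h K M hP
  refine ⟨[S.subst (FieldExpr.eval K.c M) x], A * M, ?_, ?_, ?_, le_rfl, hQ⟩
  · rw [← Matrix.inv_eq_right_inv hA]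
    simp only [ElimTree.run]
    congr!
  · simp only [List.map_cons, List.map_nil, List.prod_singleton, ← Matrix.mul_assoc, hA,
      Matrix.one_mul]
  · simpa only [List.mem_singleton, forall_eq] using hlegal

theorem of_realizes {A : ∀ K : Setting π 𝒜, K.k → Matrix ι ι K.k} (hA : S.Realizes A)
    (hinv : ∀ K t, A K (-t) * A K t = 1) (a : FieldExpr ι π)
    (h : ∀ K M, P K M → Q K (A K (a.eval K.c M) * M)) : S.Reduces P Q 1 := by
  obtain ⟨x, hx⟩ := hA (.mul (.int (-1)) a)
  refine peel x fun K M hP => ⟨(hx K M).1, A K (a.eval K.c M), ?_, h K M hP⟩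
  rw [(hx K M).2, FieldExpr.eval, FieldExpr.eval, Int.cast_neg, Int.cast_one, neg_one_mul]
  exact hinv K _

end LetterSystem.Reduces

end Reductions

/-! ## Similitudes and isometries of a monomial form -/

section Similitudes

variable {ι κ : Type} [Fintype ι] [Fintype κ] {k : Type u} [Field k]

/-- `M` multiplies the form `β` by `c`. In contrast to `HasMultiplier`, this is a condition on
matrices. -/
def IsSimilitude (β : Matrix ι ι k) (c : k) (M : Matrix ι ι k) : Prop :=
  Mᵀ * β * M = c • β

theorem IsSimilitude.mul {β M N : Matrix ι ι k} {c d : k} (hM : IsSimilitude β c M)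
    (hN : IsSimilitude β d N) : IsSimilitude β (c * d) (M * N) := by
  calc (M * N)ᵀ * β * (M * N) = Nᵀ * (Mᵀ * β * M) * N := by
        simp only [transpose_mul, Matrix.mul_assoc]
    _ = (c * d) • β := by rw [hM, Matrix.mul_smul, Matrix.smul_mul, hN, smul_smul]

theorem IsSimilitude.of_fromBlocks {β A : Matrix ι ι k}
    {γ D : Matrix κ κ k} {c : k}
    (h : IsSimilitude (fromBlocks β 0 0 γ) c (fromBlocks A 0 0 D)) : IsSimilitude β c A := by
  simp only [IsSimilitude, fromBlocks_transpose, fromBlocks_multiply, fromBlocks_smul,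
    transpose_zero, Matrix.mul_zero, Matrix.zero_mul, add_zero] at h
  exact (fromBlocks_inj.1 h).1

end Similitudes

section Isometries

variable {ι : Type} [DecidableEq ι] {k : Type u} [Field k]

/-- The form which pairs `r` with `opp r` to the value `b r`. -/
def monoForm (opp : ι → ι) (b : ι → k) : Matrix ι ι k :=
  of fun r s => if s = opp r then b r else 0

/-- The Siegel transformation which adds `t` times row `h` to row `r`: the exponential of `t` times
a skew endomorphism `X` with `X ^ 3 = 0`, where `X ^ 2 = 0` unless `r` is anisotropic. -/
def siegel (opp : ι → ι) (b : ι → k) (h r : ι) (t : k) : Matrix ι ι k :=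
  1 + t • (e r h - (b r / b h) • e (opp h) (opp r))
    - (if opp r = r then t ^ 2 * b r / (2 * b h) else 0) • e (opp h) h

/-- The transvection of a symplectic form which adds `t` times row `h` to row `opp h`. -/
def transvection (opp : ι → ι) (h : ι) (t : k) : Matrix ι ι k :=
  1 + t • e (opp h) h

/-- The reflection which interchanges rows `h` and `opp h` and changes their signs. -/
def reflection (opp : ι → ι) (h : ι) : Matrix ι ι k :=
  1 - e h h - e (opp h) (opp h) - e h (opp h) - e (opp h) h

theorem transpose_e (i j : ι) : (e i j : Matrix ι ι k)ᵀ = e j i :=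
  transpose_single i j 1

theorem siegel_symm {opp : ι → ι} {b : ι → k} {h r : ι} (hopp : opp.Involutive) {σ : k}
    (hσ : ∀ r, b (opp r) = σ * b r) (hb : ∀ r, b r ≠ 0) (hh : h ≠ opp h) (hr : opp r ≠ r) (t : k) :
    siegel opp b h r t = siegel opp b (opp r) (opp h) (-(b r / b h) * t) := by
  have key : b r / b h * (b (opp h) / b (opp r)) = 1 := by
    have hbh := hb h
    have hbr := hb r
    have hσ0 : σ ≠ 0 := left_ne_zero_of_mul (hσ r ▸ hb (opp r))
    rw [hσ, hσ]
    field_simp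
  simp only [siegel, if_neg hr, hopp r, hopp h, if_neg hh, smul_sub, smul_smul, zero_smul,
    sub_zero]
  rw [show -(b r / b h) * t * (b (opp h) / b (opp r)) = -t by linear_combination -t * key]
  module

variable [Fintype ι]

theorem IsSimilitude.of_transpose_mul {β A B : Matrix ι ι k} (h : Aᵀ * β = β * B)
    (hBA : B * A = 1) : IsSimilitude β 1 A := by
  rw [IsSimilitude, h, Matrix.mul_assoc, hBA, Matrix.mul_one, one_smul]

theorem e_mul_e (i j l m : ι) : (e i j : Matrix ι ι k) * e l m = if j = l then e i m else 0 := by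
  split_ifs with h
  · rw [h, e, e, e, single_mul_single_same, one_mul]
  · exact single_mul_single_of_ne _ _ _ _ h _

theorem e_mul_apply (i j : ι) (M : Matrix ι ι k) (x c : ι) :
    ((e i j : Matrix ι ι k) * M) x c = if x = i then M j c else 0 := by
  split_ifs with h
  · rw [h, e, single_mul_apply_same, one_mul]
  · exact single_mul_apply_of_ne _ _ _ _ _ h _

theorem mul_e_apply (i j : ι) (M : Matrix ι ι k) (x c : ι) :
    (M * (e i j : Matrix ι ι k)) x c = if c = j then M x i else 0 := by
  split_ifs with h
  · rw [h, e, mul_single_apply_same, mul_one]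
  · exact mul_single_apply_of_ne _ _ _ _ _ h _

theorem siegel_mul_apply (opp : ι → ι) (b : ι → k) (h r : ι) (t : k) (M : Matrix ι ι k)
    (x c : ι) :
    (siegel opp b h r t * M) x c = M x c + (if x = r then t * M h c else 0)
      - (if x = opp h then t * b r / b h * M (opp r) c else 0)
      - (if x = opp h ∧ opp r = r then t ^ 2 * b r / (2 * b h) * M h c else 0) := by
  simp only [siegel, Matrix.sub_mul, Matrix.add_mul, Matrix.one_mul, Matrix.smul_mul, smul_sub,
    Matrix.sub_apply, Matrix.add_apply, Matrix.smul_apply, e_mul_apply, smul_eq_mul, ite_and]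
  split_ifs <;> ring

theorem transvection_mul_apply (opp : ι → ι) (h : ι) (t : k) (M : Matrix ι ι k) (x c : ι) :
    (transvection opp h t * M) x c = M x c + if x = opp h then t * M h c else 0 := by
  rw [transvection, Matrix.add_mul, Matrix.one_mul, Matrix.smul_mul, Matrix.add_apply,
    Matrix.smul_apply, e_mul_apply, smul_eq_mul, mul_ite, mul_zero]

theorem reflection_mul_apply (opp : ι → ι) (h : ι) (M : Matrix ι ι k) (x c : ι) :
    ((reflection opp h : Matrix ι ι k) * M) x c = M x c - (if x = h then M h c else 0)
      - (if x = opp h then M (opp h) c else 0) - (if x = h then M (opp h) c else 0)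
      - (if x = opp h then M h c else 0) := by
  simp only [reflection, Matrix.sub_mul, Matrix.one_mul, Matrix.sub_apply, e_mul_apply]

variable {opp : ι → ι} {b : ι → k} {h r : ι}

theorem siegel_mul_siegel (hopp : opp.Involutive) (hb : ∀ r, b r ≠ 0)
    (two_ne : opp r = r → (2 : k) ≠ 0) (hh : h ≠ opp h) (hrh : r ≠ h) (hr : r ≠ opp h) (s t : k) :
    siegel opp b h r s * siegel opp b h r t = siegel opp b h r (s + t) := by
  have hr' : opp r ≠ opp h := hopp.injective.ne hrh
  have hbh := hb h
  rw [← Matrix.mul_one (siegel opp b h r t), ← Matrix.mul_one (siegel opp b h r (s + t))]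
  ext x c
  simp only [siegel_mul_apply, if_neg hrh.symm, if_neg hr', hh, false_and, if_false]
  by_cases hfix : opp r = r
  · have h2 := two_ne hfix
    simp only [hfix, and_true, if_neg hr]
    by_cases hx : x = opp h
    · simp only [hx, if_neg hr.symm, if_true]
      field_simp
      ring
    · simp only [if_neg hx]
      split_ifs <;> ring
  · simp only [hfix, and_false, if_false]
    split_ifs <;> ring

theorem siegel_neg_mul_siegel (hopp : opp.Involutive) (hb : ∀ r, b r ≠ 0)
    (two_ne : opp r = r → (2 : k) ≠ 0) (hh : h ≠ opp h) (hrh : r ≠ h) (hr : r ≠ opp h) (t : k) :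
    siegel opp b h r (-t) * siegel opp b h r t = 1 := by
  rw [siegel_mul_siegel hopp hb two_ne hh hrh hr, neg_add_cancel]
  simp [siegel]

theorem transvection_neg_mul_transvection (hh : h ≠ opp h) (t : k) :
    transvection opp h (-t) * transvection opp h t = 1 := by
  simp only [transvection, Matrix.add_mul, Matrix.mul_add, Matrix.one_mul, Matrix.mul_one,
    Matrix.smul_mul, Matrix.mul_smul, e_mul_e, if_neg hh, smul_zero, add_zero]
  module

theorem reflection_mul_reflection (hh : h ≠ opp h) :
    (reflection opp h : Matrix ι ι k) * reflection opp h = 1 := by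
  simp only [reflection, Matrix.sub_mul, Matrix.mul_sub, Matrix.one_mul, Matrix.mul_one, e_mul_e,
    if_neg hh, if_neg hh.symm, if_true]
  abel

theorem monoForm_mul_e (hopp : opp.Involutive) (i j : ι) :
    monoForm opp b * e i j = b (opp i) • e (opp i) j := by
  ext x y
  have hx : i = opp x ↔ opp i = x := eq_comm.trans (hopp.eq_iff.trans eq_comm)
  rw [mul_e_apply, Matrix.smul_apply, e, single_apply, smul_eq_mul, mul_ite, mul_one, mul_zero,
    monoForm, of_apply]
  simp only [hx, eq_comm (a := y), ← ite_and, and_comm]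
  split_ifs with hxy
  · rw [hxy.2]
  · rfl

theorem e_mul_monoForm (i j : ι) : e i j * monoForm opp b = b j • e i (opp j) := by
  ext x y
  rw [e_mul_apply, Matrix.smul_apply, e, single_apply, smul_eq_mul, mul_ite, mul_one, mul_zero,
    monoForm, of_apply]
  simp only [eq_comm (b := x), eq_comm (b := y), ite_and]

section Forms

variable (hopp : opp.Involutive) {σ : k} (hσ : ∀ r, b (opp r) = σ * b r) (hb : ∀ r, b r ≠ 0)

include hopp hσ hb

theorem transpose_siegel_mul_monoForm (t : k) :
    (siegel opp b h r t)ᵀ * monoForm opp b = monoForm opp b * siegel opp b h r (-t) := by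
  have hbh := hb h
  have hcross : b r / b h * b (opp h) = b (opp r) := by rw [hσ, hσ]; field_simp
  have hdiag : opp r = r → b (opp h) = b h := fun hfix => by
    have : σ = 1 := by simpa [hfix, hb r] using (hσ r).symm
    rw [hσ, this, one_mul]
  simp only [siegel, transpose_sub, transpose_add, transpose_smul, transpose_one, transpose_e,
    Matrix.sub_mul, Matrix.mul_sub, Matrix.add_mul, Matrix.mul_add, Matrix.smul_mul,
    Matrix.mul_smul, e_mul_monoForm, monoForm_mul_e hopp, hopp h, Matrix.one_mul,
    Matrix.mul_one, smul_smul, hcross, div_mul_cancel₀ _ hbh, neg_sq]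
  split_ifs with hfix
  · rw [hdiag hfix, neg_smul, smul_sub, smul_sub]
    abel
  · rw [neg_smul, smul_sub, smul_sub, zero_mul, zero_smul, zero_mul, zero_smul]
    abel

theorem isSimilitude_siegel (two_ne : opp r = r → (2 : k) ≠ 0) (hh : h ≠ opp h) (hrh : r ≠ h)
    (hr : r ≠ opp h) (t : k) : IsSimilitude (monoForm opp b) 1 (siegel opp b h r t) :=
  .of_transpose_mul (transpose_siegel_mul_monoForm hopp hσ hb t)
    (siegel_neg_mul_siegel hopp hb two_ne hh hrh hr t)

end Forms

theorem isSimilitude_transvection (hopp : opp.Involutive) (hσ : ∀ r, b (opp r) = -b r)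
    (hh : h ≠ opp h) (t : k) : IsSimilitude (monoForm opp b) 1 (transvection opp h t) := by
  refine .of_transpose_mul ?_ (transvection_neg_mul_transvection hh t)
  simp only [transvection, transpose_add, transpose_smul, transpose_one, transpose_e,
    Matrix.add_mul, Matrix.mul_add, Matrix.one_mul, Matrix.mul_one, Matrix.smul_mul,
    Matrix.mul_smul, e_mul_monoForm, monoForm_mul_e hopp, hopp h, hσ, smul_smul]
  module

theorem isSimilitude_reflection (hopp : opp.Involutive) (hσ : ∀ r, b (opp r) = b r)
    (hh : h ≠ opp h) : IsSimilitude (monoForm opp b) 1 (reflection opp h) := by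
  refine .of_transpose_mul ?_ (reflection_mul_reflection hh)
  simp only [reflection, transpose_sub, transpose_one, transpose_e, Matrix.sub_mul, Matrix.mul_sub,
    Matrix.one_mul, Matrix.mul_one, e_mul_monoForm, monoForm_mul_e hopp, hopp h, hσ]
  abel

namespace IsSimilitude

variable {c : k} {M : Matrix ι ι k} {i j : ι}

theorem sum_eq (hM : IsSimilitude (monoForm opp b) c M) (i j : ι) :
    ∑ x, M x i * b x * M (opp x) j = if j = opp i then c * b i else 0 := by
  have h := congrFun₂ hM i j
  rw [Matrix.mul_assoc, mul_apply, Matrix.smul_apply, monoForm, of_apply, smul_eq_mul, mul_ite,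
    mul_zero] at h
  rw [← h]
  refine Finset.sum_congr rfl fun x _ => ?_
  rw [transpose_apply, mul_apply, mul_assoc]
  simp [of_apply]

theorem pivot_mul (hM : IsSimilitude (monoForm opp b) c M) (hb : ∀ r, b r ≠ 0)
    (hi : ∀ x ≠ i, M x i = 0) (j : ι) : M i i * M (opp i) j = if j = opp i then c else 0 := by
  have h := hM.sum_eq i j
  rw [Finset.sum_eq_single i (fun x _ hx => by rw [hi x hx, zero_mul, zero_mul]) (by simp)] at h
  refine mul_right_cancel₀ (hb i) ?_
  rw [mul_right_comm, h, ite_mul, zero_mul]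

theorem exists_ne_zero (hM : IsSimilitude (monoForm opp b) c M) (hb : ∀ r, b r ≠ 0) (hc : c ≠ 0)
    (i : ι) : ∃ x, M x i ≠ 0 := by
  by_contra! hzero
  have h := hM.sum_eq i (opp i)
  rw [if_pos rfl] at h
  refine mul_ne_zero hc (hb i) (h.symm.trans (Finset.sum_eq_zero fun x _ => ?_))
  rw [hzero, zero_mul, zero_mul]

theorem apply_opp_eq_zero (hM : IsSimilitude (monoForm opp b) c M) (hopp : opp.Involutive)
    (hσ : ∀ r, b (opp r) = b r) (hb : ∀ r, b r ≠ 0) (two_ne : (2 : k) ≠ 0) (hi : i ≠ opp i)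
    (hzero : ∀ x, x ≠ i → x ≠ opp i → M x i = 0) (hpivot : M i i ≠ 0) : M (opp i) i = 0 := by
  have h := hM.sum_eq i i
  rw [if_neg hi, ← Finset.sum_subset (Finset.subset_univ {i, opp i}) fun x _ hx => ?_,
    Finset.sum_pair hi, hσ, hopp i] at h
  · have : 2 * b i * M i i * M (opp i) i = 0 := by linear_combination h
    simpa [two_ne, hb i, hpivot] using this
  · rw [Finset.mem_insert, Finset.mem_singleton, not_or] at hx
    rw [hzero x hx.1 hx.2, zero_mul, zero_mul]

end IsSimilitude

end Isometries

/-! ## Elimination for a monomial form -/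

/-- A letter system on a space with a monomial form which is the sum of `l` hyperbolic planes,
spanned by the indices `hyp x`, and of a core. The sign `σ` is `-1` if the form is alternating and
`1` if it is symmetric. The letters are those of the Siegel transformations, taken up to the
symmetry `siegel_symm`, and of the transvections, resp. of the last reflection. -/
structure RootDatum (ι π Γ : Type) (𝒜 : ∀ (k : Type u) [Field k], (π → k) → Prop)
    [Fintype ι] [DecidableEq ι] (l : ℕ) extends LetterSystem.{u} ι π Γ 𝒜 where
  opp : ι → ι
  opp_involutive : opp.Involutive
  hyp : EvenIdx l ↪ ι
  opp_hyp : ∀ x, opp (hyp x) = hyp x.swap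
  σ : ℤˣ
  b : ∀ K : Setting π 𝒜, ι → K.k
  b_ne_zero : ∀ K r, b K r ≠ 0
  b_opp : ∀ K r, b K (opp r) = ((σ : ℤ) : K.k) * b K r
  b_hyp_inl : ∀ K i, b K (hyp (.inl i)) = 1
  opp_ne : σ = -1 → ∀ r, opp r ≠ r
  two_ne_zero : σ = 1 → ∀ K : Setting π 𝒜, (2 : K.k) ≠ 0
  realizes_inl_inl : ∀ i j, i ≠ j →
    toLetterSystem.Realizes fun K t => siegel opp (b K) (hyp (.inl j)) (hyp (.inl i)) t
  realizes_inr_inl : ∀ i j, i < j →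
    toLetterSystem.Realizes fun K t => siegel opp (b K) (hyp (.inr j)) (hyp (.inl i)) t
  realizes_inl_inr : ∀ i j, i < j →
    toLetterSystem.Realizes fun K t => siegel opp (b K) (hyp (.inl j)) (hyp (.inr i)) t
  realizes_core : ∀ x, ∀ r ∉ Set.range hyp,
    toLetterSystem.Realizes fun K t => siegel opp (b K) (hyp x) r t
  realizes_transvection : σ = -1 → ∀ x,
    toLetterSystem.Realizes fun _ t => transvection opp (hyp x) t
  realizes_reflection : σ = 1 → ∀ i : Fin l, i.val + 1 = l →
    toLetterSystem.Realizes fun _ _ => reflection opp (hyp (.inl i))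

namespace RootDatum

variable {ι π Γ : Type} {𝒜 : ∀ (k : Type u) [Field k], (π → k) → Prop} [Fintype ι]
  [DecidableEq ι] {l : ℕ} (S : RootDatum ι π Γ 𝒜 l) {K : Setting π 𝒜}

/-- The form of a root datum. -/
abbrev form (K : Setting π 𝒜) : Matrix ι ι K.k :=
  monoForm S.opp (S.b K)

theorem hyp_ne_opp (x : EvenIdx l) : S.hyp x ≠ S.opp (S.hyp x) := by
  rw [S.opp_hyp, S.hyp.injective.ne_iff]
  cases x <;> simp

theorem two_ne_zero_of_opp_eq (K : Setting π 𝒜) {r : ι} (hr : S.opp r = r) : (2 : K.k) ≠ 0 :=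
  (Int.units_eq_one_or S.σ).elim (fun h => S.two_ne_zero h K) fun h => (S.opp_ne h r hr).elim

theorem b_opp_of_eq_one (hσ : S.σ = 1) (K : Setting π 𝒜) (r : ι) :
    S.b K (S.opp r) = S.b K r := by
  rw [S.b_opp, hσ, Units.val_one, Int.cast_one, one_mul]

theorem b_opp_of_eq_neg_one (hσ : S.σ = -1) (K : Setting π 𝒜) (r : ι) :
    S.b K (S.opp r) = -S.b K r := by
  rw [S.b_opp, hσ, Units.val_neg, Units.val_one, Int.cast_neg, Int.cast_one, neg_one_mul]

theorem exists_b_hyp_eq (x : EvenIdx l) : ∃ z : ℤˣ, ∀ K, S.b K (S.hyp x) = ((z : ℤ) : K.k) := by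
  rcases x with i | i
  · exact ⟨1, fun K => by rw [S.b_hyp_inl, Units.val_one, Int.cast_one]⟩
  · exact ⟨S.σ, fun K => by rw [← Sum.swap_inl, ← S.opp_hyp, S.b_opp, S.b_hyp_inl, mul_one]⟩

theorem exists_b_div_b_eq (x y : EvenIdx l) :
    ∃ z : ℤ, ∀ K, S.b K (S.hyp y) / S.b K (S.hyp x) = (z : K.k) := by
  obtain ⟨z, hz⟩ := S.exists_b_hyp_eq x
  obtain ⟨w, hw⟩ := S.exists_b_hyp_eq y
  refine ⟨w * z, fun K => ?_⟩
  have hzz : ((z : ℤ) : K.k) * ((z : ℤ) : K.k) = 1 := by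
    rw [← Int.cast_mul, ← Units.val_mul, Int.units_mul_self, Units.val_one, Int.cast_one]
  rw [div_eq_iff (S.b_ne_zero K _), hw, hz, Int.cast_mul, mul_assoc, hzz, mul_one]

theorem realizes_siegel_of_swap {x y : EvenIdx l}
    (h : S.Realizes fun K t => siegel S.opp (S.b K) (S.hyp y.swap) (S.hyp x.swap) t) :
    S.Realizes fun K t => siegel S.opp (S.b K) (S.hyp x) (S.hyp y) t := by
  obtain ⟨z, hz⟩ := S.exists_b_div_b_eq x y
  convert h.int_mul (-z) using 3 with K t
  rw [siegel_symm S.opp_involutive (S.b_opp K) (S.b_ne_zero K) (S.hyp_ne_opp x)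
    (S.hyp_ne_opp y).symm, hz, S.opp_hyp, S.opp_hyp, Int.cast_neg]

theorem realizes_siegel_hyp {x y : EvenIdx l} (hxy : y ≠ x) (hxy' : y ≠ x.swap) :
    S.Realizes fun K t => siegel S.opp (S.b K) (S.hyp x) (S.hyp y) t := by
  rcases x with j | j <;> rcases y with i | i
  · exact S.realizes_inl_inl i j fun h => hxy (congrArg _ h)
  · rcases lt_or_gt_of_ne fun h => hxy' (congrArg Sum.inr h) with h | h
    · exact S.realizes_inl_inr i j h
    · exact S.realizes_siegel_of_swap (S.realizes_inl_inr j i h)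
  · rcases lt_or_gt_of_ne fun h => hxy' (congrArg Sum.inl h) with h | h
    · exact S.realizes_inr_inl i j h
    · exact S.realizes_siegel_of_swap (S.realizes_inr_inl j i h)
  · exact S.realizes_siegel_of_swap (S.realizes_inl_inl j i fun h => hxy (congrArg _ h.symm))

theorem realizes_siegel {x : EvenIdx l} {r : ι} (hr : r ≠ S.hyp x) (hr' : r ≠ S.opp (S.hyp x)) :
    S.Realizes fun K t => siegel S.opp (S.b K) (S.hyp x) r t := by
  by_cases h : r ∈ Set.range S.hyp
  · obtain ⟨y, rfl⟩ := h
    rw [S.opp_hyp] at hr'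
    exact S.realizes_siegel_hyp (fun h => hr (congrArg _ h)) fun h => hr' (congrArg _ h)
  · exact S.realizes_core x r h

section RowOperations

variable {P Q : ∀ K : Setting π 𝒜, Matrix ι ι K.k → Prop}

theorem reduces_siegel {x : EvenIdx l} {r : ι} (hr : r ≠ S.hyp x) (hr' : r ≠ S.opp (S.hyp x))
    (a : FieldExpr ι π)
    (h : ∀ K M, P K M → Q K (siegel S.opp (S.b K) (S.hyp x) r (a.eval K.c M) * M)) :
    S.Reduces P Q 1 :=
  .of_realizes (S.realizes_siegel hr hr')
    (fun K => siegel_neg_mul_siegel S.opp_involutive (S.b_ne_zero K) (S.two_ne_zero_of_opp_eq K)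
      (S.hyp_ne_opp x) hr hr') a h

theorem reduces_transvection (hσ : S.σ = -1) (x : EvenIdx l) (a : FieldExpr ι π)
    (h : ∀ K M, P K M → Q K (transvection S.opp (S.hyp x) (a.eval K.c M) * M)) :
    S.Reduces P Q 1 :=
  .of_realizes (S.realizes_transvection hσ x)
    (fun _ => transvection_neg_mul_transvection (S.hyp_ne_opp x)) a h

theorem reduces_reflection (hσ : S.σ = 1) {i : Fin l} (hi : i.val + 1 = l)
    (h : ∀ K M, P K M → Q K (reflection S.opp (S.hyp (.inl i)) * M)) : S.Reduces P Q 1 :=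
  .of_realizes (S.realizes_reflection hσ i hi)
    (fun _ _ => reflection_mul_reflection (S.hyp_ne_opp _)) (.int 0) h

end RowOperations

/-- A similitude in the course of the elimination: the columns with index in `D` have no entries
off the diagonal, and those with index in `U` have the diagonal entry `1`. -/
structure Cleared (D U : Set ι) (K : Setting π 𝒜) (M : Matrix ι ι K.k) : Prop where
  isSimilitude : IsSimilitude (S.form K) K.μ M
  apply_eq_zero : ∀ c ∈ D, ∀ x ≠ c, M x c = 0
  apply_self : ∀ c ∈ U, M c c = 1

namespace Cleared

variable {S} {D U : Set ι} {M : Matrix ι ι K.k} {x : EvenIdx l} {c r : ι}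

theorem pivot_mul (hM : S.Cleared D U K M) (hc : c ∈ D) (j : ι) :
    M c c * M (S.opp c) j = if j = S.opp c then (K.μ : K.k) else 0 :=
  hM.isSimilitude.pivot_mul (S.b_ne_zero K) (hM.apply_eq_zero c hc) j

theorem pivot_mul_opp (hM : S.Cleared D U K M) (hc : c ∈ D) :
    M c c * M (S.opp c) (S.opp c) = K.μ := by
  rw [hM.pivot_mul hc, if_pos rfl]

theorem pivot_opp_ne_zero (hM : S.Cleared D U K M) (hc : c ∈ D) :
    M (S.opp c) (S.opp c) ≠ 0 :=
  right_ne_zero_of_mul ((hM.pivot_mul_opp hc).symm ▸ K.μ.ne_zero)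

theorem pivot_ne_zero (hM : S.Cleared D U K M) (hc : c ∈ D) : M c c ≠ 0 :=
  left_ne_zero_of_mul ((hM.pivot_mul_opp hc).symm ▸ K.μ.ne_zero)

theorem apply_eq_zero_of_opp_mem (hM : S.Cleared D U K M) (hr : S.opp r ∈ D) {j : ι}
    (hj : j ≠ r) : M r j = 0 := by
  have h := hM.pivot_mul hr j
  rw [S.opp_involutive r, if_neg hj] at h
  exact (mul_eq_zero.1 h).resolve_left (hM.pivot_ne_zero hr)

theorem anti_right {V : Set ι} (hM : S.Cleared D U K M) (hVU : V ⊆ U) : S.Cleared D V K M :=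
  ⟨hM.isSimilitude, hM.apply_eq_zero, fun c hc => hM.apply_self c (hVU hc)⟩

theorem of_isometry (hM : S.Cleared D U K M) {A : Matrix ι ι K.k}
    (hA : IsSimilitude (S.form K) 1 A) (hcol : ∀ c ∈ D, ∀ x, (A * M) x c = M x c)
    (hdiag : ∀ c ∈ U \ D, (A * M) c c = M c c) : S.Cleared D U K (A * M) where
  isSimilitude := one_mul (K.μ : K.k) ▸ hA.mul hM.isSimilitude
  apply_eq_zero c hc x hx := (hcol c hc x).trans (hM.apply_eq_zero c hc x hx)
  apply_self c hc := by
    by_cases hcD : c ∈ D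
    · exact (hcol c hcD c).trans (hM.apply_self c hc)
    · exact (hdiag c ⟨hc, hcD⟩).trans (hM.apply_self c hc)

theorem siegel_mul (hM : S.Cleared D U K M) (hx : S.hyp x ∉ D) (hU : U ⊆ insert (S.hyp x) D)
    (hr : r ≠ S.hyp x) (hr' : r ≠ S.opp (S.hyp x)) (hrD : S.opp r ∉ D) (t : K.k) :
    S.Cleared D U K (siegel S.opp (S.b K) (S.hyp x) r t * M) := by
  refine hM.of_isometry (isSimilitude_siegel S.opp_involutive (S.b_opp K) (S.b_ne_zero K)
    (S.two_ne_zero_of_opp_eq K) (S.hyp_ne_opp x) hr hr' t) (fun c hc y => ?_) fun c hc => ?_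
  · rw [siegel_mul_apply, hM.apply_eq_zero c hc _ (ne_of_mem_of_not_mem hc hx).symm,
      hM.apply_eq_zero c hc _ (ne_of_mem_of_not_mem hc hrD).symm]
    simp only [mul_zero, ite_self, add_zero, sub_zero]
  · obtain rfl : c = S.hyp x := (hU hc.1).resolve_right hc.2
    simp only [siegel_mul_apply, if_neg hr.symm, S.hyp_ne_opp x, false_and, if_false, add_zero,
      sub_zero]

theorem transvection_mul (hM : S.Cleared D U K M) (hσ : S.σ = -1) (hx : S.hyp x ∉ D)
    (hU : U ⊆ insert (S.hyp x) D) (t : K.k) :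
    S.Cleared D U K (transvection S.opp (S.hyp x) t * M) := by
  refine hM.of_isometry (isSimilitude_transvection S.opp_involutive (S.b_opp_of_eq_neg_one hσ K)
    (S.hyp_ne_opp x) t) (fun c hc y => ?_) fun c hc => ?_
  · rw [transvection_mul_apply, hM.apply_eq_zero c hc _ (ne_of_mem_of_not_mem hc hx).symm,
      mul_zero, ite_self, add_zero]
  · obtain rfl : c = S.hyp x := (hU hc.1).resolve_right hc.2
    rw [transvection_mul_apply, if_neg (S.hyp_ne_opp x), add_zero]

theorem reflection_mul (hM : S.Cleared D U K M) (hσ : S.σ = 1) (hx : S.hyp x ∉ D)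
    (hx' : S.opp (S.hyp x) ∉ D) (hU : U ⊆ D) :
    S.Cleared D U K (reflection S.opp (S.hyp x) * M) := by
  refine hM.of_isometry (isSimilitude_reflection S.opp_involutive (S.b_opp_of_eq_one hσ K)
    (S.hyp_ne_opp x)) (fun c hc y => ?_) fun c hc => (hc.2 (hU hc.1)).elim
  rw [reflection_mul_apply, hM.apply_eq_zero c hc _ (ne_of_mem_of_not_mem hc hx).symm,
    hM.apply_eq_zero c hc _ (ne_of_mem_of_not_mem hc hx').symm]
  simp only [ite_self, sub_zero]

end Cleared

end RootDatum

/-- The expression `-(a / b)`. -/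
def FieldExpr.negDiv {ι π : Type} (a b : FieldExpr ι π) : FieldExpr ι π :=
  .mul (.int (-1)) (.mul a (.inv b))

theorem FieldExpr.eval_negDiv {ι π : Type} {k : Type*} [Field k] (c : π → k) (M : Matrix ι ι k)
    (a b : FieldExpr ι π) : (negDiv a b).eval c M = -(a.eval c M / b.eval c M) := by
  rw [negDiv, eval, eval, eval, eval, Int.cast_neg, Int.cast_one, neg_one_mul, div_eq_mul_inv]

/-- The multiple of row `h` which has to be added to row `q` in order that the entries of column
`h` in the rows `h` and `q` have sum `1`. -/
def FieldExpr.complement {ι π : Type} (h q : ι) : FieldExpr ι π :=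
  negDiv (.add (.add (.entry h h) (.entry q h)) (.int (-1))) (.entry h h)

theorem FieldExpr.add_eval_complement_mul {ι π : Type} {k : Type*} [Field k] (c : π → k)
    {M : Matrix ι ι k} {h : ι} (hM : M h h ≠ 0) (q : ι) :
    M q h + (complement h q).eval c M * M h h = 1 - M h h := by
  rw [complement, eval_negDiv]
  simp only [eval, Int.cast_neg, Int.cast_one]
  rw [neg_mul, div_mul_cancel₀ _ hM]
  ring

namespace RootDatum

variable {ι π Γ : Type} {𝒜 : ∀ (k : Type u) [Field k], (π → k) → Prop} [Fintype ι]
  [DecidableEq ι] {l : ℕ} (S : RootDatum ι π Γ 𝒜 l) {D U : Set ι} {x y : EvenIdx l}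

section Clearing

variable (hx : S.hyp x ∉ D) (hU : U ⊆ insert (S.hyp x) D)

include hx hU

theorem reduces_clear_row (r : ι) (s : Finset ι) :
    S.Reduces
      (fun K M => S.Cleared D U K M ∧ M (S.hyp x) (S.hyp x) ≠ 0 ∧
        ∀ z ∈ s, z ≠ S.hyp x → z ≠ S.opp (S.hyp x) → M z (S.hyp x) = 0)
      (fun K M => S.Cleared D U K M ∧ M (S.hyp x) (S.hyp x) ≠ 0 ∧
        ∀ z ∈ insert r s, z ≠ S.hyp x → z ≠ S.opp (S.hyp x) → M z (S.hyp x) = 0) 1 := by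
  by_cases hr : r = S.hyp x ∨ r = S.opp (S.hyp x) ∨ S.opp r ∈ D
  · refine .of_imp fun K M ⟨hM, hpivot, hzero⟩ => ⟨hM, hpivot, fun z hz hzx hzx' => ?_⟩
    rcases Finset.mem_insert.1 hz with rfl | hz
    · have hD : S.opp z ∈ D := (hr.resolve_left hzx).resolve_left hzx'
      exact hM.apply_eq_zero_of_opp_mem hD hzx.symm
    · exact hzero z hz hzx hzx'
  · push Not at hr
    obtain ⟨hrx, hrx', hrD⟩ := hr
    refine S.reduces_siegel hrx hrx' (.negDiv (.entry r (S.hyp x)) (.entry (S.hyp x) (S.hyp x)))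
      fun K M ⟨hM, hpivot, hzero⟩ =>
        ⟨hM.siegel_mul hx hU hrx hrx' hrD _, ?_, fun z hz hzx hzx' => ?_⟩
    · simpa only [siegel_mul_apply, if_neg hrx.symm, S.hyp_ne_opp x, false_and, if_false,
        add_zero, sub_zero] using hpivot
    · simp only [siegel_mul_apply, hzx', false_and, if_false, sub_zero, FieldExpr.eval_negDiv,
        FieldExpr.eval]
      split_ifs with hzr
      · rw [hzr, neg_mul, div_mul_cancel₀ _ hpivot, add_neg_cancel]
      · rw [hzero z (Finset.mem_of_mem_insert_of_ne hz hzr) hzx hzx', add_zero]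

theorem reduces_clear_opp :
    S.Reduces
      (fun K M => S.Cleared D U K M ∧ M (S.hyp x) (S.hyp x) ≠ 0 ∧
        ∀ z, z ≠ S.hyp x → z ≠ S.opp (S.hyp x) → M z (S.hyp x) = 0)
      (S.Cleared (insert (S.hyp x) D) U) 1 := by
  have hinsert : ∀ {K : Setting π 𝒜} {M : Matrix ι ι K.k}, S.Cleared D U K M →
      (∀ z, z ≠ S.hyp x → z ≠ S.opp (S.hyp x) → M z (S.hyp x) = 0) →
      M (S.opp (S.hyp x)) (S.hyp x) = 0 → S.Cleared (insert (S.hyp x) D) U K M :=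
    fun {K M} hM hzero hopp =>
      { isSimilitude := hM.isSimilitude
        apply_self := hM.apply_self
        apply_eq_zero := by
          rintro c (rfl | hc) z hz
          · by_cases hz' : z = S.opp (S.hyp x)
            · exact hz' ▸ hopp
            · exact hzero z hz hz'
          · exact hM.apply_eq_zero c hc z hz }
  rcases Int.units_eq_one_or S.σ with hσ | hσ
  · exact .of_imp fun K M ⟨hM, hpivot, hzero⟩ => hinsert hM hzero <|
      hM.isSimilitude.apply_opp_eq_zero S.opp_involutive (S.b_opp_of_eq_one hσ K) (S.b_ne_zero K)
        (S.two_ne_zero hσ K) (S.hyp_ne_opp x) hzero hpivot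
  · refine S.reduces_transvection hσ x
      (.negDiv (.entry (S.opp (S.hyp x)) (S.hyp x)) (.entry (S.hyp x) (S.hyp x)))
      fun K M ⟨hM, hpivot, hzero⟩ =>
        hinsert (hM.transvection_mul hσ hx hU _) (fun z hz hz' => ?_) ?_
    · rw [transvection_mul_apply, if_neg hz', add_zero, hzero z hz hz']
    · rw [transvection_mul_apply, if_pos rfl, FieldExpr.eval_negDiv, FieldExpr.eval,
        FieldExpr.eval, neg_mul, div_mul_cancel₀ _ hpivot, add_neg_cancel]

theorem reduces_clear :
    S.Reduces (fun K M => S.Cleared D U K M ∧ M (S.hyp x) (S.hyp x) ≠ 0)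
      (S.Cleared (insert (S.hyp x) D) U) (Fintype.card ι + 1) := by
  have hrows := LetterSystem.Reduces.loop _ (S.reduces_clear_row hx hU) Finset.univ
  rw [Finset.card_univ, mul_one] at hrows
  exact (hrows.imp_left fun K M h => ⟨h.1, h.2, by simp⟩).trans
    ((S.reduces_clear_opp hx hU).imp_left fun K M h =>
      ⟨h.1, h.2.1, fun z => h.2.2 z (Finset.mem_univ z)⟩)

theorem reduces_clear_pair (hx' : S.opp (S.hyp x) ∉ D) :
    S.Reduces (fun K M => S.Cleared D U K M ∧ M (S.hyp x) (S.hyp x) ≠ 0)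
      (S.Cleared (insert (S.opp (S.hyp x)) (insert (S.hyp x) D)) U)
      ((Fintype.card ι + 1) + (Fintype.card ι + 1)) := by
  have hx'' : S.hyp x.swap ∉ insert (S.hyp x) D := by
    rw [← S.opp_hyp]
    exact fun h => h.elim (S.hyp_ne_opp x).symm hx'
  have hsecond := S.reduces_clear hx'' (hU.trans (Set.subset_insert _ _))
  rw [← S.opp_hyp] at hsecond
  exact (S.reduces_clear hx hU).trans
    (hsecond.imp_left fun K M hM => ⟨hM, hM.pivot_opp_ne_zero (Set.mem_insert _ _)⟩)

end Clearing

/-- A second hyperbolic index whose row is available for operations on row `hyp x`: in the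
symmetric case rows `hyp x` and `opp (hyp x)` cannot be added to each other. -/
structure Partner (D : Set ι) (x y : EvenIdx l) : Prop where
  ne : y ≠ x
  eq_neg_one : y = x.swap → S.σ = -1
  notMem : S.hyp y ∉ D

section Pivoting

variable {S} (hD : ∀ c ∈ D, S.opp c ∈ D) (hU : U ⊆ D) (hx : S.hyp x ∉ D)

theorem Partner.symm (h : S.Partner D x y) (hx : S.hyp x ∉ D) : S.Partner D y x where
  ne := h.ne.symm
  eq_neg_one hxy := h.eq_neg_one (by rw [hxy, Sum.swap_swap])
  notMem := hx

include hD

theorem opp_notMem {c : ι} (hc : c ∉ D) : S.opp c ∉ D :=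
  fun h => hc (S.opp_involutive c ▸ hD _ h)

theorem hyp_swap_notMem (hx : S.hyp x ∉ D) : S.hyp x.swap ∉ D :=
  S.opp_hyp x ▸ opp_notMem hD hx

include hU hx

theorem reduces_add_row {P Q : ∀ K : Setting π 𝒜, Matrix ι ι K.k → Prop}
    (hy : S.Partner D x y) (a : FieldExpr ι π) (hP : ∀ K M, P K M → S.Cleared D U K M)
    (h : ∀ K M N, P K M → S.Cleared D U K N → N (S.hyp x) = M (S.hyp x) →
      N (S.hyp y) = M (S.hyp y) + a.eval K.c M • M (S.hyp x) → Q K N) : S.Reduces P Q 1 := by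
  have hU' : U ⊆ insert (S.hyp x) D := hU.trans (Set.subset_insert _ _)
  by_cases hyx : y = x.swap
  · refine S.reduces_transvection (hy.eq_neg_one hyx) x a fun K M hPM =>
      h K M _ hPM ((hP K M hPM).transvection_mul (hy.eq_neg_one hyx) hx hU' _) ?_ ?_ <;> ext c
    · rw [transvection_mul_apply, if_neg (S.hyp_ne_opp x), add_zero]
    · rw [transvection_mul_apply, hyx, ← S.opp_hyp, if_pos rfl]
      rfl
  · have hr : S.hyp y ≠ S.hyp x := S.hyp.injective.ne hy.ne
    have hr' : S.hyp y ≠ S.opp (S.hyp x) := S.opp_hyp x ▸ S.hyp.injective.ne hyx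
    refine S.reduces_siegel hr hr' a fun K M hPM =>
      h K M _ hPM ((hP K M hPM).siegel_mul hx hU' hr hr' (opp_notMem hD hy.notMem) _) ?_ ?_ <;>
        ext c
    · rw [siegel_mul_apply, if_neg hr.symm, if_neg (S.hyp_ne_opp x),
        if_neg fun h => S.hyp_ne_opp x h.1, add_zero, sub_zero, sub_zero]
    · rw [siegel_mul_apply, if_pos rfl, if_neg hr', if_neg fun h => hr' h.1, sub_zero, sub_zero]
      rfl

/-- If column `h` vanishes in the rows `h` and `opp h`, then every row `opp r` can be added to row
`h` by a single Siegel transformation. -/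
theorem reduces_pivot_of_opp_eq_zero :
    S.Reduces
      (fun K M => (S.Cleared D U K M ∧ M (S.hyp x) (S.hyp x) = 0) ∧
        M (S.opp (S.hyp x)) (S.hyp x) = 0)
      (fun K M => S.Cleared D U K M ∧ M (S.hyp x) (S.hyp x) ≠ 0) 1 := by
  have hx' := hyp_swap_notMem hD hx
  have hopp : S.opp (S.hyp x.swap) = S.hyp x := by rw [S.opp_hyp, Sum.swap_swap]
  refine .search {r | r ≠ S.hyp x ∧ r ≠ S.opp (S.hyp x)} (fun r => .entry r (S.hyp x))
    (fun r hr => ?_) (.of_false fun K M ⟨⟨⟨hM, hpivot⟩, hpivot'⟩, hzero⟩ => ?_)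
  · obtain ⟨hrx, hrx'⟩ := (Finset.mem_filter.1 hr).2
    have hne : S.opp r ≠ S.hyp x.swap := S.opp_hyp x ▸ S.opp_involutive.injective.ne hrx
    have hne' : S.opp r ≠ S.opp (S.hyp x.swap) := by
      rwa [hopp, Ne, S.opp_involutive.eq_iff]
    refine S.reduces_siegel hne hne' (.int 1) fun K M ⟨⟨⟨hM, hpivot⟩, hpivot'⟩, hr⟩ =>
      ⟨hM.siegel_mul hx' (hU.trans (Set.subset_insert _ _)) hne hne' (fun hrD => hr ?_) _, ?_⟩
    · rw [S.opp_involutive r] at hrD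
      exact hM.apply_eq_zero_of_opp_mem (hD r hrD) hrx.symm
    · have hb := div_ne_zero (S.b_ne_zero K (S.opp r)) (S.b_ne_zero K (S.hyp x.swap))
      rw [siegel_mul_apply, hopp, if_neg (hopp ▸ hne'.symm), hpivot, S.opp_involutive r,
        ← S.opp_hyp, hpivot', mul_zero, ite_self, add_zero, sub_zero, zero_sub, if_pos rfl,
        FieldExpr.eval, Int.cast_one, one_mul, S.opp_hyp]
      exact neg_ne_zero.2 (mul_ne_zero hb hr)
  · obtain ⟨r, hr⟩ := hM.isSimilitude.exists_ne_zero (S.b_ne_zero K) K.μ.ne_zero (S.hyp x)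
    refine hr (hzero r (Finset.mem_filter.2 ⟨Finset.mem_univ r, ?_, ?_⟩))
    · exact fun h => hr (h ▸ hpivot)
    · exact fun h => hr (h ▸ hpivot')

theorem reduces_pivot_of_partner_ne_zero (hy : S.Partner D x y) :
    S.Reduces
      (fun K M => (S.Cleared D U K M ∧ M (S.hyp y) (S.hyp x) ≠ 0) ∧ M (S.hyp x) (S.hyp x) = 0)
      (fun K M => S.Cleared D U K M ∧ M (S.hyp x) (S.hyp x) ≠ 0) 1 := by
  refine reduces_add_row hD hU hy.notMem (hy.symm hx) (.int 1) (fun K M hM => hM.1.1)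
    fun K M N ⟨⟨_, hne⟩, hpivot⟩ hN _ hrow => ⟨hN, ?_⟩
  rwa [hrow, Pi.add_apply, hpivot, zero_add, FieldExpr.eval, Int.cast_one, one_smul]

theorem reduces_pivot_of_partner (hy : S.Partner D x y) :
    S.Reduces
      (fun K M => (S.Cleared D U K M ∧ M (S.hyp x) (S.hyp x) = 0) ∧
        M (S.opp (S.hyp x)) (S.hyp x) ≠ 0)
      (fun K M => S.Cleared D U K M ∧ M (S.hyp x) (S.hyp x) ≠ 0) 2 := by
  have hadd := reduces_pivot_of_partner_ne_zero hD hU hx hy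
  refine .ite (.entry (S.hyp y) (S.hyp x))
    ((hadd.imp_left fun K M h => ⟨⟨h.1.1.1, h.2⟩, h.1.1.2⟩).mono one_le_two) ?_
  by_cases hyx : y = x.swap
  · exact .of_false fun K M h => h.1.2 (S.opp_hyp x ▸ hyx ▸ h.2)
  have hfill : S.Reduces
      (fun K M => ((S.Cleared D U K M ∧ M (S.hyp x) (S.hyp x) = 0) ∧
        M (S.opp (S.hyp x)) (S.hyp x) ≠ 0) ∧ M (S.hyp y) (S.hyp x) = 0)
      (fun K M => S.Cleared D U K M ∧ M (S.hyp y) (S.hyp x) ≠ 0) 1 := by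
    refine reduces_add_row (x := x.swap) hD hU (hyp_swap_notMem hD hx)
      ⟨hyx, fun h => (hy.ne (h.trans x.swap_swap)).elim, hy.notMem⟩ (.int 1)
      (fun K M h => h.1.1.1) fun K M N ⟨⟨_, hne⟩, hzero⟩ hN _ hrow => ⟨hN, ?_⟩
    rwa [hrow, Pi.add_apply, hzero, zero_add, FieldExpr.eval, Int.cast_one, one_smul, ← S.opp_hyp]
  exact hfill.trans (.ite (.entry (S.hyp x) (S.hyp x)) (.of_imp fun K M h => ⟨h.1.1, h.2⟩) hadd)

theorem reduces_pivot_of_last {i : Fin l} (hxi : x = .inl i) (hσ : S.σ = 1) (hi : i.val + 1 = l) :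
    S.Reduces
      (fun K M => (S.Cleared D U K M ∧ M (S.hyp x) (S.hyp x) = 0) ∧
        M (S.opp (S.hyp x)) (S.hyp x) ≠ 0)
      (fun K M => S.Cleared D U K M ∧ M (S.hyp x) (S.hyp x) ≠ 0) 1 := by
  subst hxi
  refine S.reduces_reflection hσ hi fun K M ⟨⟨hM, hpivot⟩, hne⟩ =>
    ⟨hM.reflection_mul hσ hx (opp_notMem hD hx) hU, ?_⟩
  rw [reflection_mul_apply, if_pos rfl, if_neg (S.hyp_ne_opp _), if_pos rfl,
    if_neg (S.hyp_ne_opp _), hpivot, sub_zero, sub_zero, sub_zero, zero_sub]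
  exact neg_ne_zero.2 hne

theorem reduces_pivot {i : Fin l} (hxi : x = .inl i)
    (hpartner : (∃ y, S.Partner D x y) ∨ S.σ = 1 ∧ i.val + 1 = l) :
    S.Reduces (S.Cleared D U) (fun K M => S.Cleared D U K M ∧ M (S.hyp x) (S.hyp x) ≠ 0) 2 := by
  refine .ite (.entry (S.hyp x) (S.hyp x)) (.of_imp fun K M h => h)
    (.ite (.entry (S.opp (S.hyp x)) (S.hyp x)) ?_
      ((reduces_pivot_of_opp_eq_zero hD hU hx).mono one_le_two))
  rcases hpartner with ⟨y, hy⟩ | ⟨hσ, hi⟩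
  · exact reduces_pivot_of_partner hD hU hx hy
  · exact (reduces_pivot_of_last hD hU hx hxi hσ hi).mono one_le_two

theorem reduces_normalise (hy : S.Partner D x y) :
    S.Reduces (fun K M => S.Cleared D U K M ∧ M (S.hyp x) (S.hyp x) ≠ 0)
      (S.Cleared D (insert (S.hyp x) U)) 2 := by
  have hcomplement : S.Reduces (fun K M => S.Cleared D U K M ∧ M (S.hyp x) (S.hyp x) ≠ 0)
      (fun K M => S.Cleared D U K M ∧
        M (S.hyp x) (S.hyp x) + M (S.hyp y) (S.hyp x) = 1) 1 := by
    refine reduces_add_row hD hU hx hy (.complement (S.hyp x) (S.hyp y)) (fun K M h => h.1)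
      fun K M N ⟨_, hne⟩ hN hsame hrow => ⟨hN, ?_⟩
    rw [hsame, hrow, Pi.add_apply, Pi.smul_apply, smul_eq_mul,
      FieldExpr.add_eval_complement_mul K.c hne, add_sub_cancel]
  refine hcomplement.trans (reduces_add_row hD hU hy.notMem (hy.symm hx) (.int 1)
    (fun K M h => h.1) fun K M N ⟨_, hsum⟩ hN _ hrow =>
      ⟨hN.isSimilitude, hN.apply_eq_zero, fun c hc => ?_⟩)
  rcases hc with rfl | hc
  · rwa [hrow, Pi.add_apply, FieldExpr.eval, Int.cast_one, one_smul]
  · exact hN.apply_self c hc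

end Pivoting

/-- The indices of the columns which are cleared after `i` stages. -/
def finished (i : ℕ) : Set ι :=
  {c | ∃ x : EvenIdx l, x.elim Fin.val Fin.val < i ∧ S.hyp x = c}

/-- The indices of the columns whose pivot is made equal to `1` in the first `i` stages. For a
symmetric form nothing can be done about the last one. -/
def normalised (i : ℕ) : Set ι :=
  {c | ∃ j : Fin l, j.val < i ∧ (S.σ = 1 → j.val + 1 ≠ l) ∧ S.hyp (.inl j) = c}

/-- The state of the elimination after `i` stages. -/
abbrev Stage (i : ℕ) (K : Setting π 𝒜) (M : Matrix ι ι K.k) : Prop :=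
  S.Cleared (S.finished i) (S.normalised i) K M

variable {S}

theorem hyp_mem_finished {i : ℕ} {x : EvenIdx l} :
    S.hyp x ∈ S.finished i ↔ x.elim Fin.val Fin.val < i := by
  simp only [finished, Set.mem_ofPred_eq, S.hyp.injective.eq_iff, exists_eq_right]

theorem opp_mem_finished {i : ℕ} : ∀ c ∈ S.finished i, S.opp c ∈ S.finished i := by
  rintro _ ⟨x, hx, rfl⟩
  rw [S.opp_hyp, hyp_mem_finished]
  cases x <;> exact hx

theorem normalised_subset_finished (i : ℕ) : S.normalised i ⊆ S.finished i := by
  rintro _ ⟨j, hj, _, rfl⟩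
  exact hyp_mem_finished.2 hj

theorem finished_succ (i : Fin l) :
    S.finished (i + 1) =
      insert (S.opp (S.hyp (.inl i))) (insert (S.hyp (.inl i)) (S.finished i)) := by
  rw [S.opp_hyp, Sum.swap_inl]
  ext c
  constructor
  · rintro ⟨x, hx, rfl⟩
    rw [Set.mem_insert_iff, Set.mem_insert_iff, hyp_mem_finished, S.hyp.injective.eq_iff,
      S.hyp.injective.eq_iff]
    rcases (Nat.lt_succ_iff.1 hx).lt_or_eq with h | h
    · exact .inr (.inr h)
    · cases x
      · exact .inr (.inl (congrArg _ (Fin.ext h)))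
      · exact .inl (congrArg _ (Fin.ext h))
  · rintro (rfl | rfl | ⟨x, hx, rfl⟩) <;> rw [hyp_mem_finished]
    exacts [i.val.lt_succ_self, i.val.lt_succ_self, hx.trans i.val.lt_succ_self]

theorem normalised_succ_subset (i : Fin l) :
    S.normalised (i + 1) ⊆ insert (S.hyp (.inl i)) (S.normalised i) := by
  rintro _ ⟨j, hj, hlast, rfl⟩
  rcases (Nat.lt_succ_iff.1 hj).lt_or_eq with h | h
  · exact .inr ⟨j, h, hlast, rfl⟩
  · exact .inl (congrArg _ (congrArg _ (Fin.ext h)))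

theorem normalised_succ_of_last {i : Fin l} (hσ : S.σ = 1) (hi : i.val + 1 = l) :
    S.normalised (i + 1) ⊆ S.normalised i := by
  rintro _ ⟨j, hj, hlast, rfl⟩
  refine ⟨j, ?_, hlast, rfl⟩
  have := hlast hσ
  omega

theorem exists_partner_or_last (i : Fin l) :
    (∃ y, S.Partner (S.finished i) (.inl i) y) ∨ S.σ = 1 ∧ i.val + 1 = l := by
  rcases Int.units_eq_one_or S.σ with hσ | hσ
  · by_cases hi : i.val + 1 = l
    · exact .inr ⟨hσ, hi⟩
    · refine .inl ⟨.inl ⟨i + 1, by omega⟩, ?_, nofun, fun h => ?_⟩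
      · simp [Fin.ext_iff]
      · have := hyp_mem_finished.1 h
        simp at this
  · exact .inl ⟨.inr i, nofun, fun _ => hσ, fun h => (hyp_mem_finished.1 h).false⟩

variable (S)

theorem reduces_normalise_stage (i : Fin l) :
    S.Reduces
      (fun K M => S.Stage i K M ∧ M (S.hyp (.inl i)) (S.hyp (.inl i)) ≠ 0)
      (fun K M => S.Cleared (S.finished i) (S.normalised (i + 1)) K M ∧
        M (S.hyp (.inl i)) (S.hyp (.inl i)) ≠ 0) 2 := by
  rcases S.exists_partner_or_last i with ⟨y, hy⟩ | ⟨hσ, hi⟩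
  · refine (reduces_normalise opp_mem_finished (normalised_subset_finished i)
      (fun h => (hyp_mem_finished.1 h).false) hy).imp_right fun K M hM =>
        ⟨hM.anti_right (normalised_succ_subset i), ?_⟩
    rw [hM.apply_self _ (Set.mem_insert _ _)]
    exact one_ne_zero
  · exact .of_imp fun K M hM => ⟨hM.1.anti_right (normalised_succ_of_last hσ hi), hM.2⟩

theorem reduces_stage_succ (i : Fin l) :
    S.Reduces (S.Stage i) (S.Stage (i + 1)) (2 * Fintype.card ι + 6) := by
  have hx : S.hyp (.inl i) ∉ S.finished i := fun h => (hyp_mem_finished.1 h).false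
  have hclear := S.reduces_clear_pair hx
    ((normalised_succ_subset i).trans (Set.insert_subset_insert (normalised_subset_finished i)))
    (opp_notMem opp_mem_finished hx)
  rw [← finished_succ] at hclear
  exact ((reduces_pivot opp_mem_finished (normalised_subset_finished i) hx rfl
    (S.exists_partner_or_last i)).trans ((S.reduces_normalise_stage i).trans hclear)).mono
      (by omega)

theorem reduces_stage {i : ℕ} (hi : i ≤ l) :
    S.Reduces (S.Stage 0) (S.Stage i) (i * (2 * Fintype.card ι + 6)) := by
  induction i with
  | zero => exact .of_imp fun _ _ h => h
  | succ i ih =>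
    rw [Nat.succ_mul]
    exact (ih (Nat.le_of_succ_le hi)).trans (S.reduces_stage_succ ⟨i, hi⟩)

/-! ## The end of the elimination -/

variable {S} {K : Setting π 𝒜} {M : Matrix ι ι K.k}

theorem stage_zero (hM : IsSimilitude (S.form K) K.μ M) : S.Stage 0 K M where
  isSimilitude := hM
  apply_eq_zero := by
    rintro c ⟨x, hx, -⟩
    exact absurd hx (Nat.not_lt_zero _)
  apply_self := by
    rintro c ⟨j, hj, -⟩
    exact absurd hj (Nat.not_lt_zero _)

theorem hyp_mem_finished_last (x : EvenIdx l) : S.hyp x ∈ S.finished l :=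
  hyp_mem_finished.2 (by cases x <;> exact Fin.is_lt _)

theorem Stage.exists_diagEntries (hM : S.Stage l K M) :
    ∃ a : K.kˣ, (S.σ = -1 → a = 1) ∧
      ∀ x, M (S.hyp x) (S.hyp x) = diagEntries l (a : K.k) K.μ x := by
  have hpivot (j : Fin l) : M (S.hyp (.inl j)) (S.hyp (.inl j)) ≠ 0 :=
    hM.pivot_ne_zero (hyp_mem_finished_last _)
  obtain ⟨a, ha, hlast⟩ : ∃ a : K.kˣ, (S.σ = -1 → a = 1) ∧
      ∀ j : Fin l, j.val + 1 = l → M (S.hyp (.inl j)) (S.hyp (.inl j)) = a := by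
    by_cases h : ∃ j : Fin l, j.val + 1 = l
    · obtain ⟨i, hi⟩ := h
      refine ⟨Units.mk0 _ (hpivot i), fun hσ => Units.ext (hM.apply_self _ ⟨i, i.2, ?_, rfl⟩),
        fun j hj => ?_⟩
      · exact fun hσ' => absurd (hσ.symm.trans hσ') (by decide)
      · rw [Units.val_mk0, show j = i from Fin.ext (by omega)]
    · exact ⟨1, fun _ => rfl, fun j hj => (h ⟨j, hj⟩).elim⟩
  have hinl (j : Fin l) :
      M (S.hyp (.inl j)) (S.hyp (.inl j)) = if j.val + 1 = l then (a : K.k) else 1 := by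
    split_ifs with hj
    · exact hlast j hj
    · exact hM.apply_self _ ⟨j, j.2, fun _ => hj, rfl⟩
  refine ⟨a, ha, Sum.rec hinl fun j => ?_⟩
  have h := hM.pivot_mul_opp (hyp_mem_finished_last (.inl j))
  rw [S.opp_hyp, mul_comm, ← eq_mul_inv_iff_mul_eq₀ (hpivot j), hinl] at h
  rw [← Sum.swap_inl, h, diagEntries, Sum.swap_inl, Sum.elim_inr]
  split_ifs
  · rfl
  · rw [inv_one, mul_one]

theorem Stage.eq_evenDiag {S : RootDatum (EvenIdx l) π Γ 𝒜 l}
    (hhyp : S.hyp = Function.Embedding.refl _) {M : Matrix (EvenIdx l) (EvenIdx l) K.k}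
    (hM : S.Stage l K M) : ∃ a : K.kˣ, (S.σ = -1 → a = 1) ∧ M = evenDiag l (a : K.k) K.μ := by
  obtain ⟨a, ha, hdiag⟩ := hM.exists_diagEntries
  refine ⟨a, ha, ?_⟩
  ext x y
  have hy : y ∈ S.finished l := by
    simpa only [hhyp, Function.Embedding.refl_apply] using hyp_mem_finished_last (S := S) y
  by_cases hxy : x = y
  · rw [hxy, evenDiag, diagonal_apply_eq, ← hdiag, hhyp, Function.Embedding.refl_apply]
  · rw [evenDiag, diagonal_apply_ne _ hxy, hM.apply_eq_zero y hy x hxy]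

theorem Stage.eq_fromBlocks {κ : Type} [Fintype κ] [DecidableEq κ]
    {S : RootDatum (κ ⊕ EvenIdx l) π Γ 𝒜 l} (hhyp : S.hyp = Function.Embedding.inr)
    {M : Matrix (κ ⊕ EvenIdx l) (κ ⊕ EvenIdx l) K.k} (hM : S.Stage l K M) :
    ∃ (N : Matrix κ κ K.k) (a : K.kˣ), M = fromBlocks N 0 0 (evenDiag l (a : K.k) K.μ) := by
  obtain ⟨a, -, hdiag⟩ := hM.exists_diagEntries
  have hfinished (y : EvenIdx l) : .inr y ∈ S.finished l := by
    simpa only [hhyp, Function.Embedding.inr_apply] using hyp_mem_finished_last (S := S) y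
  refine ⟨M.toBlocks₁₁, a, ?_⟩
  ext (x | x) (y | y)
  · rfl
  · exact hM.apply_eq_zero _ (hfinished y) _ Sum.inl_ne_inr
  · exact hM.apply_eq_zero_of_opp_mem (opp_mem_finished _ (hfinished x)) Sum.inl_ne_inr
  · rw [fromBlocks_apply₂₂]
    by_cases hxy : x = y
    · rw [hxy, evenDiag, diagonal_apply_eq, ← hdiag, hhyp, Function.Embedding.inr_apply]
    · rw [evenDiag, diagonal_apply_ne _ hxy]
      exact hM.apply_eq_zero _ (hfinished y) _ (Sum.inr_injective.ne hxy)

end RootDatum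

/-! ## The four families -/

theorem elimination_length_le {l n : ℕ} (hn : n ≤ 2 * l + 1) :
    l * (2 * n + 6) ≤ 12 * l ^ 3 := by
  calc l * (2 * n + 6) ≤ l * (2 * (2 * l + 1) + 6) := by gcongr
    _ = 4 * l ^ 2 + 8 * l := by ring
    _ ≤ 12 * l ^ 3 := by
      rcases l.eq_zero_or_pos with rfl | hl
      · rfl
      · linarith [Nat.le_self_pow three_ne_zero l, Nat.pow_le_pow_right hl (Nat.le_succ 2)]

section Symplectic

variable (l : ℕ)

/-- The root datum of `GSp(2l, k)`, with empty core. -/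
def gspDatum : RootDatum.{u} (EvenIdx l) Empty (GSpLetter l (FieldExpr (EvenIdx l) Empty))
    (fun _ _ _ => True) l where
  Letter := GSpLetter l
  subst := GSpLetter.map
  mat _ := GSpLetter.toMatrix
  Legal _ _ := True
  opp := Sum.swap
  opp_involutive := Sum.swap_swap
  hyp := .refl _
  opp_hyp _ := rfl
  σ := -1
  b _ := Sum.elim 1 (-1)
  b_ne_zero _ := by simp
  b_opp _ := by simp
  b_hyp_inl _ _ := rfl
  opp_ne _ := by simp
  two_ne_zero h := absurd h (by decide)
  realizes_inl_inl i j h a :=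
    ⟨.x i j h a, fun K M => ⟨trivial, by simp [GSpLetter.map, GSpLetter.toMatrix, siegel]⟩⟩
  realizes_inr_inl i j h a :=
    ⟨.xUp i j h a, fun K M => ⟨trivial, by simp [GSpLetter.map, GSpLetter.toMatrix, siegel]⟩⟩
  realizes_inl_inr i j h a :=
    ⟨.xDown i j h a, fun K M => ⟨trivial, by simp [GSpLetter.map, GSpLetter.toMatrix, siegel]⟩⟩
  realizes_core _ r hr := absurd ⟨r, rfl⟩ hr
  realizes_transvection _
    | .inl i, a => ⟨.xDownDiag i a, fun K M => ⟨trivial, rfl⟩⟩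
    | .inr i, a => ⟨.xUpDiag i a, fun K M => ⟨trivial, rfl⟩⟩
  realizes_reflection h := absurd h (by decide)

theorem form_gspDatum (K : Setting.{u} Empty fun _ _ _ => True) :
    (gspDatum l).form K = symplecticForm l K.k := by
  ext (i | i) (j | j) <;>
    simp [gspDatum, monoForm, symplecticForm, one_apply, eq_comm, apply_ite]

theorem reduces_gsp :
    (gspDatum.{u} l).Reduces (fun K M => IsSimilitude (symplecticForm l K.k) K.μ M)
      (fun K M => M = evenDiag l 1 (K.μ : K.k)) (12 * l ^ 3) := by
  refine (((gspDatum l).reduces_stage le_rfl).imp_left fun K M hM => ?_).mono ?_ |>.imp_right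
    fun K M hM => ?_
  · exact RootDatum.stage_zero (by rwa [form_gspDatum])
  · exact elimination_length_le (by simp; omega)
  · obtain ⟨a, ha, rfl⟩ := hM.eq_evenDiag rfl
    rw [ha rfl, Units.val_one]

end Symplectic

section EvenOrthogonal

variable (l : ℕ)

/-- The root datum of `GO(2l, k)`, with empty core. -/
def goEvenDatum : RootDatum.{u} (EvenIdx l) Empty (GOEvenLetter l (FieldExpr (EvenIdx l) Empty))
    (fun k _ _ => (2 : k) ≠ 0) l where
  Letter := GOEvenLetter l
  subst := GOEvenLetter.map
  mat _ := GOEvenLetter.toMatrix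
  Legal _ _ := True
  opp := Sum.swap
  opp_involutive := Sum.swap_swap
  hyp := .refl _
  opp_hyp _ := rfl
  σ := 1
  b _ := 1
  b_ne_zero _ := by simp
  b_opp _ := by simp
  b_hyp_inl _ _ := rfl
  opp_ne _ := by simp
  two_ne_zero _ K := K.admissible
  realizes_inl_inl i j h a :=
    ⟨.x i j h a, fun K M => ⟨trivial, by simp [GOEvenLetter.map, GOEvenLetter.toMatrix, siegel]⟩⟩
  realizes_inr_inl i j h a :=
    ⟨.xUp i j h a, fun K M => ⟨trivial, by simp [GOEvenLetter.map, GOEvenLetter.toMatrix, siegel]⟩⟩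
  realizes_inl_inr i j h a :=
    ⟨.xDown i j h a, fun K M =>
      ⟨trivial, by simp [GOEvenLetter.map, GOEvenLetter.toMatrix, siegel]⟩⟩
  realizes_core _ r hr := absurd ⟨r, rfl⟩ hr
  realizes_transvection h := absurd h (by decide)
  realizes_reflection _ i h _ := ⟨.w i h, fun K M => ⟨trivial, rfl⟩⟩

theorem form_goEvenDatum (K : Setting.{u} Empty fun k _ _ => (2 : k) ≠ 0) :
    (goEvenDatum l).form K = evenForm l K.k := by
  ext (i | i) (j | j) <;> simp [goEvenDatum, monoForm, evenForm, one_apply, eq_comm]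

theorem reduces_goEven :
    (goEvenDatum.{u} l).Reduces (fun K M => IsSimilitude (evenForm l K.k) K.μ M)
      (fun K M => ∃ a : K.kˣ, M = evenDiag l (a : K.k) K.μ) (12 * l ^ 3) := by
  refine (((goEvenDatum l).reduces_stage le_rfl).imp_left fun K M hM => ?_).mono ?_ |>.imp_right
    fun K M hM => ?_
  · exact RootDatum.stage_zero (by rwa [form_goEvenDatum])
  · exact elimination_length_le (by simp; omega)
  · obtain ⟨a, -, h⟩ := hM.eq_evenDiag rfl
    exact ⟨a, h⟩

end EvenOrthogonal

section OddOrthogonal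

variable (l : ℕ)

/-- The root datum of `GO(2l+1, k)`, whose core is the index `0`. -/
def goOddDatum : RootDatum.{u} (OddIdx l) Empty (GOOddLetter l (FieldExpr (OddIdx l) Empty))
    (fun k _ _ => (2 : k) ≠ 0) l where
  Letter := GOOddLetter l
  subst := GOOddLetter.map
  mat _ := GOOddLetter.toMatrix
  Legal _ _ := True
  opp := Sum.map id Sum.swap
  opp_involutive := by rintro (r | r | r) <;> rfl
  hyp := .inr
  opp_hyp _ := rfl
  σ := 1
  b _ := Sum.elim 2 1
  b_ne_zero K := by simpa using K.admissible
  b_opp _ := by simp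
  b_hyp_inl _ _ := rfl
  opp_ne h := absurd h (by decide)
  two_ne_zero _ K := K.admissible
  realizes_inl_inl i j h a :=
    ⟨.x i j h a, fun K M => ⟨trivial, by simp [GOOddLetter.map, GOOddLetter.toMatrix, siegel]⟩⟩
  realizes_inr_inl i j h a :=
    ⟨.xUp i j h a, fun K M => ⟨trivial, by simp [GOOddLetter.map, GOOddLetter.toMatrix, siegel]⟩⟩
  realizes_inl_inr i j h a :=
    ⟨.xDown i j h a, fun K M =>
      ⟨trivial, by simp [GOOddLetter.map, GOOddLetter.toMatrix, siegel]⟩⟩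
  realizes_core
    | .inl i, .inl (), _, a => ⟨.xZeroLeft i a, fun K M => ⟨trivial, by
        simp [GOOddLetter.map, GOOddLetter.toMatrix, siegel, K.admissible, neg_add_eq_sub]⟩⟩
    | .inr i, .inl (), _, a => ⟨.xZeroRight i (.mul (.int (-1)) a), fun K M => ⟨trivial, by
        simp [GOOddLetter.map, GOOddLetter.toMatrix, siegel, K.admissible, FieldExpr.eval,
          ← smul_neg]⟩⟩
    | _, .inr r, hr, _ => absurd ⟨r, rfl⟩ hr
  realizes_transvection h := absurd h (by decide)
  realizes_reflection _ i h _ := ⟨.w i h, fun K M => ⟨trivial, rfl⟩⟩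

theorem form_goOddDatum (K : Setting.{u} Empty fun k _ _ => (2 : k) ≠ 0) :
    (goOddDatum l).form K = oddForm l K.k := by
  ext (i | i | i) (j | j | j) <;>
    simp [goOddDatum, monoForm, oddForm, evenForm, one_apply, eq_comm]

theorem sq_eq_of_isSimilitude {k : Type u} [Field k] (h2 : (2 : k) ≠ 0) {c : k}
    {N : Matrix Unit Unit k} (hN : IsSimilitude (diagonal fun _ => 2) c N) :
    N () () ^ 2 = c := by
  have h : N () () * 2 * N () () = c * 2 := by simpa [mul_apply] using congrFun₂ hN () ()
  refine mul_left_cancel₀ h2 ?_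
  linear_combination h

theorem reduces_goOdd :
    (goOddDatum.{u} l).Reduces (fun K M => IsSimilitude (oddForm l K.k) K.μ M)
      (fun K M => ∃ α a : K.kˣ, α ^ 2 = K.μ ∧ M = oddDiag l (α : K.k) (a : K.k) K.μ)
      (12 * l ^ 3) := by
  refine (((goOddDatum l).reduces_stage le_rfl).imp_left fun K M hM => ?_).mono ?_ |>.imp_right
    fun K M hM => ?_
  · exact RootDatum.stage_zero (by rwa [form_goOddDatum])
  · exact elimination_length_le (by simp; omega)
  · obtain ⟨N, a, rfl⟩ := hM.eq_fromBlocks rfl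
    have hN : N () () ^ 2 = K.μ := sq_eq_of_isSimilitude K.admissible
      (.of_fromBlocks ((form_goOddDatum l K) ▸ hM.isSimilitude))
    have hα : N () () ≠ 0 := (pow_ne_zero_iff two_ne_zero).1 (hN ▸ K.μ.ne_zero)
    refine ⟨.mk0 _ hα, a, Units.ext hN, ?_⟩
    rw [oddDiag, evenDiag, ← fromBlocks_diagonal]
    rfl

end OddOrthogonal

section TwistedOrthogonal

variable (m : ℕ)

/-- The root datum of `GO⁻(2l, q)` with `l = m + 1`, whose core are the indices `1, -1`. The letters
`x_1(t, s)` and `x_2` act on the core only and do not enter its axioms. -/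
def goTwistedDatum :
    RootDatum.{u} (TwIdx m) Unit (GOTwistedLetter m (FieldExpr (TwIdx m) Unit))
      (fun k _ c => (2 : k) ≠ 0 ∧ c () ≠ 0) m where
  Letter := GOTwistedLetter m
  subst := GOTwistedLetter.map
  mat K := GOTwistedLetter.toMatrix (K.c ())
  Legal K y := ∀ t s, y = .x1 t s → t ^ 2 + K.c () * s ^ 2 = K.μ
  opp := Sum.map id Sum.swap
  opp_involutive := by rintro (r | r | r) <;> rfl
  hyp := .inr
  opp_hyp _ := rfl
  σ := 1
  b K := Sum.elim ![1, K.c ()] 1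
  b_ne_zero K := by simpa using K.admissible.2
  b_opp _ := by simp
  b_hyp_inl _ _ := rfl
  opp_ne h := absurd h (by decide)
  two_ne_zero _ K := K.admissible.1
  realizes_inl_inl i j h a := ⟨.x i j h a, fun K M =>
    ⟨nofun, by simp [GOTwistedLetter.map, GOTwistedLetter.toMatrix, siegel]⟩⟩
  realizes_inr_inl i j h a := ⟨.xUp i j h a, fun K M =>
    ⟨nofun, by simp [GOTwistedLetter.map, GOTwistedLetter.toMatrix, siegel]⟩⟩
  realizes_inl_inr i j h a := ⟨.xDown i j h a, fun K M =>
    ⟨nofun, by simp [GOTwistedLetter.map, GOTwistedLetter.toMatrix, siegel]⟩⟩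
  realizes_core
    | .inl i, .inl 0, _, a => ⟨.xOneRight i a, fun K M => ⟨nofun, by
        simp [GOTwistedLetter.map, GOTwistedLetter.toMatrix, siegel, neg_add_eq_sub]⟩⟩
    | .inr i, .inl 0, _, a => ⟨.xOneLeft i (.mul (.int (-1)) a), fun K M => ⟨nofun, by
        simp [GOTwistedLetter.map, GOTwistedLetter.toMatrix, siegel, FieldExpr.eval, ← smul_neg]⟩⟩
    | .inl i, .inl 1, _, a => ⟨.xNegOneRight i a, fun K M => ⟨nofun, by
        simp [GOTwistedLetter.map, GOTwistedLetter.toMatrix, siegel, neg_add_eq_sub, mul_comm]⟩⟩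
    | .inr i, .inl 1, _, a => ⟨.xNegOneLeft i (.mul (.int (-1)) a), fun K M => ⟨nofun, by
        simp [GOTwistedLetter.map, GOTwistedLetter.toMatrix, siegel, FieldExpr.eval, ← smul_neg,
          mul_comm]⟩⟩
    | _, .inr r, hr, _ => absurd ⟨r, rfl⟩ hr
  realizes_transvection h := absurd h (by decide)
  realizes_reflection _ i _ _ := ⟨.w i, fun K M => ⟨nofun, rfl⟩⟩

theorem form_goTwistedDatum (K : Setting.{u} Unit fun k _ c => (2 : k) ≠ 0 ∧ c () ≠ 0) :
    (goTwistedDatum m).form K = twistedForm m (K.c ()) := by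
  ext (i | i | i) (j | j | j) <;>
    simp [goTwistedDatum, monoForm, twistedForm, evenForm, one_apply, diagonal_apply, eq_comm]

section Core

variable {k : Type u} [Field k] {m}

/-- The block of `x_1(t, s)` on the indices `1, -1`. -/
def coreBlock (ε t s : k) : Matrix (Fin 2) (Fin 2) k :=
  !![t, ε * s; s, -t]

theorem coreBlock_mul_self (ε t s : k) :
    coreBlock ε t s * coreBlock ε t s = (t ^ 2 + ε * s ^ 2) • (1 : Matrix (Fin 2) (Fin 2) k) := by
  ext i j
  fin_cases i <;> fin_cases j <;> simp [coreBlock] <;> ring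

theorem toMatrix_x1 (ε t s : k) :
    (GOTwistedLetter.x1 t s : GOTwistedLetter m k).toMatrix ε =
      fromBlocks (coreBlock ε t s) 0 0 1 := by
  ext (i | i) (j | j)
  · fin_cases i <;> fin_cases j <;> simp [GOTwistedLetter.toMatrix, coreBlock, e, mul_comm]
  all_goals simp [GOTwistedLetter.toMatrix, e, one_apply]

theorem toMatrix_x2 (ε : k) :
    (GOTwistedLetter.x2 : GOTwistedLetter m k).toMatrix ε =
      fromBlocks (diagonal ![1, -1]) 0 0 1 := by
  ext (i | i) (j | j)
  · fin_cases i <;> fin_cases j <;> simp [GOTwistedLetter.toMatrix, e]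
    ring
  all_goals simp [GOTwistedLetter.toMatrix, e, one_apply]

theorem twistedDiag_eq_fromBlocks (a c : k) :
    twistedDiag m a c = fromBlocks 1 0 0 (evenDiag m a c) := by
  rw [twistedDiag, evenDiag, ← fromBlocks_diagonal, diagonal_one]

variable {ε c : k} {N : Matrix (Fin 2) (Fin 2) k}

theorem norm_of_isSimilitude (hN : IsSimilitude (diagonal ![1, ε]) c N) :
    N 0 0 ^ 2 + ε * N 1 0 ^ 2 = c := by
  have h : N 0 0 * N 0 0 + N 1 0 * ε * N 1 0 = c := by
    simpa [mul_apply, Fin.sum_univ_two] using congrFun₂ hN 0 0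
  linear_combination h

theorem exists_coreBlock_mul_eq (hN : IsSimilitude (diagonal ![1, ε]) c N) (hε : ε ≠ 0)
    (hc : c ≠ 0) :
    ∃ d : k, (d = 1 ∨ d = -1) ∧ coreBlock ε (N 0 0) (N 1 0) * N = c • diagonal ![1, d] := by
  have hdet : N.det * N.det = c * c := by
    have h : N.det * ε * N.det = c ^ 2 * ε := by simpa using congrArg det hN
    refine mul_left_cancel₀ hε ?_
    linear_combination h
  have h01 : N 0 0 * N 0 1 + N 1 0 * ε * N 1 1 = 0 := by
    simpa [mul_apply, Fin.sum_univ_two] using congrFun₂ hN 0 1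
  refine ⟨-N.det / c, ?_, ?_⟩
  · rcases mul_self_eq_mul_self_iff.1 hdet with h | h <;> simp [h, hc]
  · ext i j
    fin_cases i <;> fin_cases j <;> simp [coreBlock, mul_apply, Fin.sum_univ_two, det_fin_two]
    · linear_combination norm_of_isSimilitude hN
    · linear_combination h01
    · ring
    · field_simp
      ring

end Core

theorem reduces_core_to_sign :
    (goTwistedDatum.{u} m).Reduces ((goTwistedDatum m).Stage m)
      (fun K M => ∃ (d : K.k) (a : K.kˣ), (d = 1 ∨ d = -1) ∧
        M = fromBlocks (diagonal ![1, d]) 0 0 (evenDiag m (a : K.k) K.μ)) 1 := by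
  refine .peel (.x1 (.entry (.inl 0) (.inl 0)) (.entry (.inl 1) (.inl 0))) fun K M hM => ?_
  obtain ⟨N, a, rfl⟩ := hM.eq_fromBlocks rfl
  have hN : IsSimilitude (diagonal ![1, K.c ()]) (K.μ : K.k) N :=
    .of_fromBlocks ((form_goTwistedDatum m K) ▸ hM.isSimilitude)
  obtain ⟨d, hd, hRN⟩ := exists_coreBlock_mul_eq hN K.admissible.2 K.μ.ne_zero
  refine ⟨?_, fromBlocks ((K.μ : K.k)⁻¹ • coreBlock (K.c ()) (N 0 0) (N 1 0)) 0 0 1, ?_,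
    d, a, hd, ?_⟩
  · rintro _ _ ⟨⟩
    exact norm_of_isSimilitude hN
  · refine (congrArg (· * _) (toMatrix_x1 _ _ _)).trans ?_
    simp only [fromBlocks_apply₁₁, FieldExpr.eval]
    rw [fromBlocks_multiply, Matrix.mul_smul, coreBlock_mul_self, norm_of_isSimilitude hN,
      inv_smul_smul₀ K.μ.ne_zero]
    simp
  · rw [fromBlocks_multiply, Matrix.smul_mul, hRN, inv_smul_smul₀ K.μ.ne_zero]
    simp

theorem reduces_sign :
    (goTwistedDatum.{u} m).Reduces
      (fun K M => ∃ (d : K.k) (a : K.kˣ), (d = 1 ∨ d = -1) ∧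
        M = fromBlocks (diagonal ![1, d]) 0 0 (evenDiag m (a : K.k) K.μ))
      (fun K M => ∃ a : K.kˣ, M = twistedDiag m (a : K.k) K.μ) 1 := by
  refine .ite (.add (.entry (.inl 1) (.inl 1)) (.int (-1))) (.peel .x2 ?_) (.of_imp ?_)
  · rintro K _ ⟨⟨d, a, hd, rfl⟩, hne⟩
    obtain rfl : d = -1 := hd.resolve_left fun h => hne (by simp [FieldExpr.eval, h])
    have hsq : diagonal ![1, -1] * diagonal ![1, -1] = (1 : Matrix (Fin 2) (Fin 2) K.k) := by
      ext i j
      fin_cases i <;> fin_cases j <;> simp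
    refine ⟨nofun, fromBlocks (diagonal ![1, -1]) 0 0 1, ?_, a, ?_⟩
    · refine (congrArg (· * _) (toMatrix_x2 (K.c ()))).trans ?_
      simp [fromBlocks_multiply, hsq, -diagonal_mul_diagonal]
    · rw [twistedDiag_eq_fromBlocks, fromBlocks_multiply, hsq]
      simp
  · rintro K _ ⟨⟨d, a, -, rfl⟩, h⟩
    obtain rfl : d = 1 := by simpa [FieldExpr.eval, add_neg_eq_zero] using h
    refine ⟨a, ?_⟩
    rw [twistedDiag_eq_fromBlocks, ← diagonal_one]
    congr! with i
    fin_cases i <;> rfl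

theorem reduces_goTwisted :
    (goTwistedDatum.{u} m).Reduces (fun K M => IsSimilitude (twistedForm m (K.c ())) K.μ M)
      (fun K M => ∃ a : K.kˣ, M = twistedDiag m (a : K.k) K.μ) (12 * (m + 1) ^ 3) := by
  refine ((((goTwistedDatum m).reduces_stage le_rfl).imp_left fun K M hM => ?_).trans
    ((reduces_core_to_sign m).trans (reduces_sign m))).mono ?_
  · exact RootDatum.stage_zero (by rwa [form_goTwistedDatum])
  · simp only [Fintype.card_sum, Fintype.card_fin]
    nlinarith [Nat.zero_le (m ^ 2), Nat.zero_le (m ^ 3)]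

end TwistedOrthogonal

end SimilitudeWord

open SimilitudeWord in
theorem theoremA_general :
    ∃ C : ℕ,
      (∀ l : ℕ, ∃ T : GSpTree l,
        ∀ (k : Type*) [Field k], ∀ g ∈ GSp l k,
          ∃ (c : kˣ) (word : List (GSpLetter l k)),
            HasMultiplier (symplecticForm l k) g c ∧
            T.run GSpLetter.map GSpLetter.toMatrix Empty.elim
                (g : Matrix _ _ k) = (word, evenDiag l 1 (c : k)) ∧
            (g : Matrix _ _ k) =
              (word.map GSpLetter.toMatrix).prod *
                evenDiag l 1 (c : k) ∧
            word.length ≤ C * l ^ 3) ∧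
      (∀ l : ℕ, ∃ T : GOEvenTree l,
        ∀ (k : Type*) [Field k], (2 : k) ≠ 0 → ∀ g ∈ GOEven l k,
          ∃ (a c : kˣ) (word : List (GOEvenLetter l k)),
            HasMultiplier (evenForm l k) g c ∧
            T.run GOEvenLetter.map GOEvenLetter.toMatrix Empty.elim
                (g : Matrix _ _ k) = (word, evenDiag l (a : k) (c : k)) ∧
            (g : Matrix _ _ k) =
              (word.map GOEvenLetter.toMatrix).prod *
                evenDiag l (a : k) (c : k) ∧
            word.length ≤ C * l ^ 3) ∧
      (∀ l : ℕ, ∃ T : GOOddTree l,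
        ∀ (k : Type*) [Field k], (2 : k) ≠ 0 → ∀ g ∈ GOOdd l k,
          ∃ (α a c : kˣ) (word : List (GOOddLetter l k)),
            HasMultiplier (oddForm l k) g c ∧
            α ^ 2 = c ∧
            T.run GOOddLetter.map GOOddLetter.toMatrix Empty.elim
                (g : Matrix _ _ k) = (word, oddDiag l (α : k) (a : k) (c : k)) ∧
            (g : Matrix _ _ k) =
              (word.map GOOddLetter.toMatrix).prod *
                oddDiag l (α : k) (a : k) (c : k) ∧
            word.length ≤ C * l ^ 3) ∧
      (∀ m : ℕ, ∃ T : GOTwistedTree m,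
        ∀ (k : Type*) [Field k], (2 : k) ≠ 0 → ∀ ε : k, ε ≠ 0 →
          ∀ g ∈ GOTwisted m ε,
          ∃ (a c : kˣ) (word : List (GOTwistedLetter m k)),
            HasMultiplier (twistedForm m ε) g c ∧
            T.run GOTwistedLetter.map (GOTwistedLetter.toMatrix ε)
                (fun _ => ε) (g : Matrix _ _ k) =
              (word, twistedDiag m (a : k) (c : k)) ∧
            (g : Matrix _ _ k) =
              (word.map (GOTwistedLetter.toMatrix ε)).prod *
                twistedDiag m (a : k) (c : k) ∧
            (∀ t s : k, GOTwistedLetter.x1 t s ∈ word →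
              t ^ 2 + ε * s ^ 2 = (c : k)) ∧
            word.length ≤ C * (m + 1) ^ 3) := by
  refine ⟨12, fun l => ?_, fun l => ?_, fun l => ?_, fun m => ?_⟩
  · obtain ⟨T, hT⟩ := reduces_gsp l
    refine ⟨T, fun k _ g ⟨c, hc⟩ => ?_⟩
    obtain ⟨word, _, hrun, hg, -, hlen, rfl⟩ := hT ⟨k, Empty.elim, trivial, c⟩ g hc
    exact ⟨c, word, hc, hrun, hg, hlen⟩
  · obtain ⟨T, hT⟩ := reduces_goEven l
    refine ⟨T, fun k _ h2 g ⟨c, hc⟩ => ?_⟩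
    obtain ⟨word, _, hrun, hg, -, hlen, a, rfl⟩ := hT ⟨k, Empty.elim, h2, c⟩ g hc
    exact ⟨a, c, word, hc, hrun, hg, hlen⟩
  · obtain ⟨T, hT⟩ := reduces_goOdd l
    refine ⟨T, fun k _ h2 g ⟨c, hc⟩ => ?_⟩
    obtain ⟨word, _, hrun, hg, -, hlen, α, a, hα, rfl⟩ := hT ⟨k, Empty.elim, h2, c⟩ g hc
    exact ⟨α, a, c, word, hc, hα, hrun, hg, hlen⟩
  · obtain ⟨T, hT⟩ := reduces_goTwisted m
    refine ⟨T, fun k _ h2 ε hε g ⟨c, hc⟩ => ?_⟩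
    obtain ⟨word, _, hrun, hg, hlegal, hlen, a, rfl⟩ := hT ⟨k, fun _ => ε, ⟨h2, hε⟩, c⟩ g hc
    exact ⟨a, c, word, hc, hrun, hg, fun t s h => hlegal _ h t s rfl, hlen⟩

theorem theoremA :
    ∃ C : ℕ,
      -- `GSp(2l, k)`
      (∀ l : ℕ, 1 ≤ l → ∃ T : SimilitudeWord.GSpTree l,
        ∀ (k : Type*) [Field k], (2 : k) ≠ 0 → ∀ g ∈ SimilitudeWord.GSp l k,
          ∃ (c : kˣ) (word : List (SimilitudeWord.GSpLetter l k)),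
            SimilitudeWord.HasMultiplier (SimilitudeWord.symplecticForm l k) g c ∧
            T.run SimilitudeWord.GSpLetter.map SimilitudeWord.GSpLetter.toMatrix Empty.elim
                (g : Matrix _ _ k) = (word, SimilitudeWord.evenDiag l 1 (c : k)) ∧
            (g : Matrix _ _ k) =
              (word.map SimilitudeWord.GSpLetter.toMatrix).prod *
                SimilitudeWord.evenDiag l 1 (c : k) ∧
            word.length ≤ C * l ^ 3) ∧
      -- `GO(2l, k)`
      (∀ l : ℕ, 1 ≤ l → ∃ T : SimilitudeWord.GOEvenTree l,
        ∀ (k : Type*) [Field k], (2 : k) ≠ 0 → ∀ g ∈ SimilitudeWord.GOEven l k,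
          ∃ (a c : kˣ) (word : List (SimilitudeWord.GOEvenLetter l k)),
            SimilitudeWord.HasMultiplier (SimilitudeWord.evenForm l k) g c ∧
            T.run SimilitudeWord.GOEvenLetter.map SimilitudeWord.GOEvenLetter.toMatrix Empty.elim
                (g : Matrix _ _ k) = (word, SimilitudeWord.evenDiag l (a : k) (c : k)) ∧
            (g : Matrix _ _ k) =
              (word.map SimilitudeWord.GOEvenLetter.toMatrix).prod *
                SimilitudeWord.evenDiag l (a : k) (c : k) ∧
            word.length ≤ C * l ^ 3) ∧
      -- `GO(2l+1, k)`
      (∀ l : ℕ, 1 ≤ l → ∃ T : SimilitudeWord.GOOddTree l,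
        ∀ (k : Type*) [Field k], (2 : k) ≠ 0 → ∀ g ∈ SimilitudeWord.GOOdd l k,
          ∃ (α a c : kˣ) (word : List (SimilitudeWord.GOOddLetter l k)),
            SimilitudeWord.HasMultiplier (SimilitudeWord.oddForm l k) g c ∧
            α ^ 2 = c ∧
            T.run SimilitudeWord.GOOddLetter.map SimilitudeWord.GOOddLetter.toMatrix Empty.elim
                (g : Matrix _ _ k) = (word, SimilitudeWord.oddDiag l (α : k) (a : k) (c : k)) ∧
            (g : Matrix _ _ k) =
              (word.map SimilitudeWord.GOOddLetter.toMatrix).prod *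
                SimilitudeWord.oddDiag l (α : k) (a : k) (c : k) ∧
            word.length ≤ C * l ^ 3) ∧
      -- `GO⁻(2l, q)` with `l = m + 1`
      (∀ m : ℕ, ∃ T : SimilitudeWord.GOTwistedTree m,
        ∀ (k : Type*) [Field k] [Finite k], (2 : k) ≠ 0 → ∀ ε : k, ¬ IsSquare ε →
          ∀ g ∈ SimilitudeWord.GOTwisted m ε,
          ∃ (a c : kˣ) (word : List (SimilitudeWord.GOTwistedLetter m k)),
            SimilitudeWord.HasMultiplier (SimilitudeWord.twistedForm m ε) g c ∧
            T.run SimilitudeWord.GOTwistedLetter.map (SimilitudeWord.GOTwistedLetter.toMatrix ε)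
                (fun _ => ε) (g : Matrix _ _ k) =
              (word, SimilitudeWord.twistedDiag m (a : k) (c : k)) ∧
            (g : Matrix _ _ k) =
              (word.map (SimilitudeWord.GOTwistedLetter.toMatrix ε)).prod *
                SimilitudeWord.twistedDiag m (a : k) (c : k) ∧
            (∀ t s : k, SimilitudeWord.GOTwistedLetter.x1 t s ∈ word →
              t ^ 2 + ε * s ^ 2 = (c : k)) ∧
            word.length ≤ C * (m + 1) ^ 3) := by
  obtain ⟨C, hGSp, hGOEven, hGOOdd, hGOTwisted⟩ := theoremA_general
  refine ⟨C, fun l _ => ?_, fun l _ => hGOEven l, fun l _ => hGOOdd l, fun m => ?_⟩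
  · exact (hGSp l).imp fun T hT k _ _ => hT k
  · exact (hGOTwisted m).imp fun T hT k _ _ h2 ε hε => hT k h2 ε fun h => hε (h ▸ .zero)
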